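/- **Theorem (Completeness for all the SFM$_0$ processes).** Let $A$ be a finite alphabet and let $\alpha$ range over $A\cup\{\epsilon\}$. SFM$_0$ terms are generated by $$s ::= \mathbf 0 \mid \alpha.\mathbf 1 \mid a.p \mid s+s \quad(\text{guarded terms}),\qquad p ::= s \mid C \quad(\text{terms}),$$ where $a\in A$ and $C$ ranges over process constants. Finitely many constants are equipped with a defining equation $C\doteq s$, $s$ guarded; the set of constants is assumed to be as large as needed, so that a deduction may use finitely many further (new) constants with defining equations of their own. A process is a term $p$ such that every constant used by $p$, directly or through the definitions of constants used by $p$, has a defining equation. Open terms are obtained by allowing variables $x$ in the category $p$. The automaton $[\![p]\!]_I=(Q,T,F,q_0)$ of $p$, where $I$ is a set of constants already found, has process terms as non-final states, $F\subseteq\{\mathbf 1\}$ as its set of final states and $q_0=p$ as its initial state; its transitions are defined as follows. * $[\![\mathbf 0]\!]_I$ and, if $C\in I$, $[\![C]\!]_I$ have one state, no transition, and $F=\emptyset$. * $[\![\alpha.\mathbf 1]\!]_I$ has the single transition $\alpha.\mathbf 1\xrightarrow{\alpha}\mathbf 1$ and $F=\{\mathbf 1\}$. * $[\![a.p]\!]_I$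 is $[\![p]\!]_I$ with the new initial state $a.p$ and the transition $a.p\xrightarrow{a}p$. * $[\![p_1+p_2]\!]_I$ is the union of $[\![p_1]\!]_I$ and $[\![p_2]\!]_I$ with the new initial state $p_1+p_2$, with a transition $p_1+p_2\xrightarrow{\alpha}r$ for each transition $p_i\xrightarrow{\alpha}r$ of $[\![p_i]\!]_I$ ($i=1,2$), and where $p_i$ and its outgoing transitions are removed from $[\![p_i]\!]_I$ if no transition of $[\![p_i]\!]_I$ reaches $p_i$. * If $C\notin I$ and $C\doteq p$, then $[\![C]\!]_I$ is $[\![p]\!]_{I\cup\{C\}}$ with the new initial state $C$, with a transition $C\xrightarrow{\alpha}r$ for each transition $p\xrightarrow{\alpha}r$, and where $p$ and its outgoing transitions are removed if no transition of $[\![p]\!]_{I\cup\{C\}}$ reaches $p$. $L(p)\subseteq A^*$ is the language recognized by $[\![p]\!]_\emptyset$, and $p\sim q$ means $L(p)=L(q)$. Let $W$ consist of the following axioms, where $x,y,z$ in A1–A4 and T2 are instantiated by guarded processes (and $a\in A$): * A1 $x+(y+z)=(x+y)+z$; A2 $x+y=y+x$; A3 $x+\mathbf 0=x$; A4 $x+x=x$;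 * T1 $a.\mathbf 0=\mathbf 0$; T2 $a.(x+y)=a.x+a.y$; T3 $a.\epsilon.\mathbf 1=a.\mathbf 1$; * R1 (unfolding) if $C\doteq p$, then $C=p$; * R2 (folding) if $C\doteq p\{C/x\}$ and $q=p\{q/x\}$, then $C=q$, where $p$ is a guarded term open on at most $x$ that does not use $C$. Substitution also closes definitions: if $p$ uses a constant $D\doteq s$ with $D$ open on $x$, then $p\{r/x\}$ uses instead a constant $D\{r/x\}$ with $D\{r/x\}\doteq s\{r/x\}$. $W\vdash p=q$ means that $p=q$ is derivable from $W$ by equational deduction (reflexivity, symmetry, transitivity, and substitutivity for $a.\_$ and $+$). Then, for all SFM$_0$ processes $p$ and $q$, if $p\sim q$, then $W\vdash p=q$. -/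

import Mathlib

namespace SFM

/-! ### Syntax -/

/-- Raw terms over the alphabet `A` and the constants `K`. A label in `A ∪ {ε}` is an element of
`Option A`, where `none` is `ε`. The constructor `var` builds open terms. -/
inductive Term (A K : Type*) where
  /-- the process `0` -/
  | zero : Term A K
  /-- the process `α.1`, for `α ∈ A ∪ {ε}` -/
  | one (α : Option A) : Term A K
  /-- the process `a.p`, for `a ∈ A` -/
  | pre (a : A) (p : Term A K) : Term A K
  /-- the process `p + q` -/
  | plus (p q : Term A K) : Term A K
  /-- a process constant -/
  | const (C : K) : Term A K
  /-- a variable -/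
  | var (x : ℕ) : Term A K

namespace Term

variable {A K : Type*}

/-- Constants and variables. -/
def IsAtom : Term A K → Prop
  | const _ => True
  | var _ => True
  | _ => False

/-- The (open) guarded terms, i.e. the syntactic category
`s ::= 0 | α.1 | a.p | s + s`, where `p ::= s | C | x`. -/
def IsGuarded : Term A K → Prop
  | zero => True
  | one _ => True
  | pre _ p => p.IsAtom ∨ p.IsGuarded
  | plus s t => s.IsGuarded ∧ t.IsGuarded
  | const _ => False
  | var _ => False

/-- The (open) terms, i.e. the syntactic category `p ::= s | C | x`. -/
def IsLegal (p : Term A K) : Prop := p.IsAtom ∨ p.IsGuarded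

/-- The variables that occur in a term (not looking into the definitions of its constants). -/
def vars : Term A K → Set ℕ
  | zero => ∅
  | one _ => ∅
  | pre _ p => p.vars
  | plus p q => p.vars ∪ q.vars
  | const _ => ∅
  | var x => {x}

/-- Replace each occurrence of the variable `x` by `r` and rename each constant `C` to `θ C`. -/
def inst (θ : K → K) (x : ℕ) (r : Term A K) : Term A K → Term A K
  | zero => zero
  | one α => one α
  | pre a p => pre a (inst θ x r p)
  | plus p q => plus (inst θ x r p) (inst θ x r q)
  | const C => const (θ C)
  | var y => if y = x then r else var y

end Term

/-- A finite set of defining equations `C ≐ s`, where `s` is an (open) guarded term: the constants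
in `dom` are the ones equipped with a definition, and `body C` is the definition of `C ∈ dom`
(the value of `body` outside `dom` is never used). -/
structure Env (A K : Type*) where
  dom : Finset K
  body : K → Term A K
  guarded : ∀ C ∈ dom, (body C).IsGuarded

namespace Env

variable {A K : Type*}

/-- `Γ.Defines C s` is the defining equation `C ≐ s`. -/
def Defines (Γ : Env A K) (C : K) (s : Term A K) : Prop := C ∈ Γ.dom ∧ Γ.body C = s

/-- `Γ'` arises from `Γ` by adding (finitely many) definitions for constants undefined in `Γ`. -/
def Extends (Γ' Γ : Env A K) : Prop := ∀ C s, Γ.Defines C s → Γ'.Defines C s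

theorem card_sdiff_insert_lt [DecidableEq K] (D I : Finset K) {C : K} (hD : C ∈ D) (hI : C ∉ I) :
    (D \ insert C I).card < (D \ I).card := by
  apply Finset.card_lt_card
  refine ⟨Finset.sdiff_subset_sdiff le_rfl (Finset.subset_insert C I), fun h => ?_⟩
  have := h (Finset.mem_sdiff.2 ⟨hD, hI⟩)
  simp at this

/-- The function `δ(p, I)` collecting the constants used by `p`, where `I` is the set of the
constants already known. -/
def delta [DecidableEq K] (Γ : Env A K) : Term A K → Finset K → Finset K
  | .zero, _ => ∅
  | .one _, _ => ∅
  | .pre _ p, I => Γ.delta p I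
  | .plus p q, I => Γ.delta p I ∪ Γ.delta q I
  | .const C, I =>
      if hI : C ∈ I then ∅
      else if hD : C ∈ Γ.dom then {C} ∪ Γ.delta (Γ.body C) (insert C I)
      else {C}
  | .var _, _ => ∅
termination_by p I => ((Γ.dom \ I).card, sizeOf p)
decreasing_by
  · exact Prod.Lex.right _ (by simp)
  · exact Prod.Lex.right _ (by simp; omega)
  · exact Prod.Lex.right _ (by simp)
  · exact Prod.Lex.left _ _ (card_sdiff_insert_lt _ _ hD hI)

/-- The set of the constants used by `p`. -/
def consts [DecidableEq K] (Γ : Env A K) (p : Term A K) : Finset K := Γ.delta p ∅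

/-- The variables on which `p` is open: those that occur in `p` or in the definition of a constant
used by `p`. -/
def fv [DecidableEq K] (Γ : Env A K) (p : Term A K) : Set ℕ :=
  {x | x ∈ p.vars ∨ ∃ C ∈ Γ.consts p, C ∈ Γ.dom ∧ x ∈ (Γ.body C).vars}

/-- `p` is an SFM₀ process: a term of the grammar, without variables, such that each constant it
uses is equipped with a definition. -/
def IsProc [DecidableEq K] (Γ : Env A K) (p : Term A K) : Prop :=
  p.IsLegal ∧ Γ.consts p ⊆ Γ.dom ∧ Γ.fv p = ∅

/-- `p` is a guarded SFM₀ process. -/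
def IsGuardedProc [DecidableEq K] (Γ : Env A K) (p : Term A K) : Prop :=
  Γ.IsProc p ∧ p.IsGuarded

/-- `p` is a guarded term, open on at most the variable `x`. -/
def IsOpenGuarded [DecidableEq K] (Γ : Env A K) (x : ℕ) (p : Term A K) : Prop :=
  p.IsGuarded ∧ Γ.consts p ⊆ Γ.dom ∧ Γ.fv p ⊆ {x}

/-- `p'` is `p{r/x}`. The substitution also closes the definitions of the constants used by `p`:
if such a constant `D ≐ s` is open on `x`, then it is replaced by a constant `θ D`, which stands for
`D{r/x}` and is defined by `θ D ≐ s{r/x}`; distinct constants stay distinct, and a constant that is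
not open on `x` is unchanged. -/
def IsSubst [DecidableEq K] (Γ : Env A K) (x : ℕ) (r p p' : Term A K) : Prop :=
  ∃ θ : K → K,
    Set.InjOn θ (Γ.consts p) ∧
    (∀ D ∈ Γ.consts p, x ∉ Γ.fv (.const D) → θ D = D) ∧
    (∀ D ∈ Γ.consts p, x ∈ Γ.fv (.const D) → ∀ s, Γ.Defines D s →
      Γ.Defines (θ D) (Term.inst θ x r s)) ∧
    p' = Term.inst θ x r p

end Env

/-! ### Automata and languages -/

/-- The tuple `(Q, A, T, F, q₀)` of an automaton with states in `S` and labels in `A ∪ {ε}`. -/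
structure Automaton (A S : Type*) where
  /-- the non-final states -/
  Q : Set S
  /-- the alphabet -/
  alph : Set A
  /-- the transitions -/
  T : Set (S × Option A × S)
  /-- the final states -/
  F : Set S
  /-- the initial state -/
  q₀ : S

namespace Automaton

variable {A S : Type*}

/-- The reachability relation `r ⇒σ r'`; the word of a label `α` is `α.toList`. -/
inductive Reach (N : Automaton A S) : S → List A → S → Prop
  | refl (r : S) (h : r ∈ N.Q ∪ N.F) : Reach N r [] r
  | single (q : S) (α : Option A) (r : S) (h : (q, α, r) ∈ N.T) : Reach N q α.toList r
  | tail (q : S) (σ : List A) (q' : S) (α : Option A) (r : S) (h : Reach N q σ q')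
      (h' : (q', α, r) ∈ N.T) : Reach N q (σ ++ α.toList) r

/-- The language recognized by `N`. -/
def language (N : Automaton A S) : Language A :=
  {σ | ∃ f ∈ N.F, N.Reach N.q₀ σ f}

/-- Some transition reaches the initial state. -/
def InitReached (N : Automaton A S) : Prop := ∃ q a, (q, some a, N.q₀) ∈ N.T

open Classical in
/-- The non-final states, without the initial one if no transition reaches it. -/
noncomputable def trimQ (N : Automaton A S) : Set S :=
  if N.InitReached then N.Q else N.Q \ {N.q₀}

open Classical in
/-- The transitions, without those leaving the initial state if no transition reaches it. -/
noncomputable def trimT (N : Automaton A S) : Set (S × Option A × S) :=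
  if N.InitReached then N.T else N.T \ {t | t.1 = N.q₀}

end Automaton

/-! ### Denotational semantics -/

/-- The states of the automaton of a process: process terms, and the final state `1`. -/
inductive State (A K : Type*) where
  | proc (p : Term A K) : State A K
  | final : State A K

namespace Env

variable {A K : Type*}

/-- The automaton with the single, non-final state `p` and no transition. -/
def deadlock (p : Term A K) : Automaton A (State A K) :=
  ⟨{.proc p}, ∅, ∅, ∅, .proc p⟩

/-- The denotational semantics: the automaton associated with `p`, where `I` is the set of the
constants already found. -/
noncomputable def den [DecidableEq K] (Γ : Env A K) :
    Term A K → Finset K → Automaton A (State A K)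
  | .zero, _ => deadlock .zero
  | .one α, _ =>
      ⟨{.proc (.one α)}, {a | α = some a}, {(.proc (.one α), α, .final)}, {.final},
        .proc (.one α)⟩
  | .pre a p, I =>
      let N := Γ.den p I
      ⟨{.proc (.pre a p)} ∪ N.Q, {a} ∪ N.alph,
        {(.proc (.pre a p), some a, .proc p)} ∪ N.T, N.F, .proc (.pre a p)⟩
  | .plus p₁ p₂, I =>
      let N₁ := Γ.den p₁ I
      let N₂ := Γ.den p₂ I
      ⟨{.proc (.plus p₁ p₂)} ∪ N₁.trimQ ∪ N₂.trimQ, N₁.alph ∪ N₂.alph,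
        {t | ∃ α r, t = (.proc (.plus p₁ p₂), α, r) ∧
          ((.proc p₁, α, r) ∈ N₁.T ∨ (.proc p₂, α, r) ∈ N₂.T)} ∪ N₁.trimT ∪ N₂.trimT,
        N₁.F ∪ N₂.F, .proc (.plus p₁ p₂)⟩
  | .const C, I =>
      if h : C ∈ Γ.dom ∧ C ∉ I then
        let N := Γ.den (Γ.body C) (insert C I)
        ⟨{.proc (.const C)} ∪ N.trimQ, N.alph,
          {t | ∃ α r, t = (.proc (.const C), α, r) ∧ (.proc (Γ.body C), α, r) ∈ N.T} ∪ N.trimT,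
          N.F, .proc (.const C)⟩
      else deadlock (.const C)
  | .var x, _ => deadlock (.var x)
termination_by p I => ((Γ.dom \ I).card, sizeOf p)
decreasing_by
  · exact Prod.Lex.right _ (by simp)
  · exact Prod.Lex.right _ (by simp; omega)
  · exact Prod.Lex.right _ (by simp)
  · exact Prod.Lex.left _ _ (card_sdiff_insert_lt _ _ h.1 h.2)

/-- The language `L(p)`. -/
noncomputable def lang [DecidableEq K] (Γ : Env A K) (p : Term A K) : Language A :=
  (Γ.den p ∅).language

/-- Language equivalence `p ∼ q`. -/
def LangEquiv [DecidableEq K] (Γ : Env A K) (p q : Term A K) : Prop := Γ.lang p = Γ.lang q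

/-! ### Equational deduction -/

/-- Equational deduction between SFM₀ processes from A1–A4, T1–T3, R1, R2, over the
definitions in `Γ`. -/
inductive Deriv [DecidableEq K] (Γ : Env A K) : Term A K → Term A K → Prop
  | refl {p} (hp : Γ.IsProc p) : Deriv Γ p p
  | symm {p q} (h : Deriv Γ p q) : Deriv Γ q p
  | trans {p q r} (h : Deriv Γ p q) (h' : Deriv Γ q r) : Deriv Γ p r
  | congr_pre (a : A) {p q} (h : Deriv Γ p q) : Deriv Γ (.pre a p) (.pre a q)
  | congr_plus {p p' q q'} (hp : p.IsGuarded) (hp' : p'.IsGuarded) (hq : q.IsGuarded)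
      (hq' : q'.IsGuarded) (h : Deriv Γ p p') (h' : Deriv Γ q q') :
      Deriv Γ (.plus p q) (.plus p' q')
  | A1 {p q r} (hp : Γ.IsGuardedProc p) (hq : Γ.IsGuardedProc q)
      (hr : Γ.IsGuardedProc r) :
      Deriv Γ (.plus p (.plus q r)) (.plus (.plus p q) r)
  | A2 {p q} (hp : Γ.IsGuardedProc p) (hq : Γ.IsGuardedProc q) :
      Deriv Γ (.plus p q) (.plus q p)
  | A3 {p} (hp : Γ.IsGuardedProc p) : Deriv Γ (.plus p .zero) p
  | A4 {p} (hp : Γ.IsGuardedProc p) : Deriv Γ (.plus p p) p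
  | T1 (a : A) : Deriv Γ (.pre a .zero) .zero
  | T2 (a : A) {p q} (hp : Γ.IsGuardedProc p) (hq : Γ.IsGuardedProc q) :
      Deriv Γ (.pre a (.plus p q)) (.plus (.pre a p) (.pre a q))
  | T3 (a : A) : Deriv Γ (.pre a (.one none)) (.one (some a))
  /-- if `C ≐ p` then `C = p` -/
  | R1 {C p} (hC : Γ.IsProc (.const C)) (h : Γ.Defines C p) : Deriv Γ (.const C) p
  /-- if `C ≐ p{C/x}` and `q = p{q/x}` then `C = q`, where `C` is not used by `p` -/
  | R2 {C : K} {x : ℕ} {p pC q pq : Term A K} (hC : Γ.IsProc (.const C))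
      (hp : Γ.IsOpenGuarded x p) (hCp : C ∉ Γ.consts p)
      (hpC : Γ.IsSubst x (.const C) p pC) (hdef : Γ.Defines C pC)
      (hpq : Γ.IsSubst x q p pq) (h : Deriv Γ q pq) : Deriv Γ (.const C) q

/-- `W ⊢ p = q`: the equality has an equational deduction proof. The finite set of constants can
be chosen as large as needed, that is, the proof may use finitely many new constants with a
definition of their own. -/
def ProvesW [DecidableEq K] (Γ : Env A K) (p q : Term A K) : Prop :=
  ∃ Γ' : Env A K, Γ'.Extends Γ ∧ Γ'.Deriv p q

end Env

end SFM

/-! Both processes are determinised inside the calculus; then one uses that a deterministic system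
of guarded equations has only one solution up to provable equality.

After unfolding a constant, a process is a finite sum of terms `α.1` and `a.p`. Its derivatives by
letters are again finite sets of such summands, taken from one finite set, and `mem_lang_iff`
identifies the language with the words accepted by this subset automaton. By A1–A4, guarded
processes modulo provable equality form a join-semilattice with least element `0`; by T1 and T2,
prefixing is a homomorphism of it. With T3 and R1, the sum of a set of summands is therefore
provably `∑ a.(sum of the a-derivative) + output` (`deriv_sumList_toList`).

For language-equivalent processes, take as unknowns all pairs of summand sets that accept the same
words. Such pairs are closed under derivatives, and their two components have the same output, so
the first components and the second components solve the same system. `System.deriv_con` proves any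
solution equal to constants defined by the system itself; it trades constants for given solution
terms one unknown at a time, each time by R2. Since the substitution in R2 also acts on definitions,
the environment must contain from the start a fresh constant for each partially solved form of the
system, named coherently enough that these substitutions map constants to constants. -/

namespace SFM

/-! ### Constants used by a term, and a characterisation of processes -/

namespace Term

variable {A K : Type*}

/-- The constants that occur in a term (not looking into definitions). -/
def syn : Term A K → Set K
  | zero => ∅
  | one _ => ∅
  | pre _ p => p.syn
  | plus p q => p.syn ∪ q.syn
  | const C => {C}
  | var _ => ∅

theorem inst_eq_self {θ : K → K} {x : ℕ} {r p : Term A K} (hv : p.vars = ∅)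
    (hθ : ∀ C ∈ p.syn, θ C = C) : inst θ x r p = p := by
  induction p with
  | zero => rfl
  | one α => rfl
  | pre a p ih => simp only [inst]; rw [ih hv hθ]
  | plus p q ihp ihq =>
    simp only [vars, Set.union_empty_iff] at hv
    simp only [inst]
    rw [ihp hv.1 fun C hC => hθ C (Or.inl hC), ihq hv.2 fun C hC => hθ C (Or.inr hC)]
  | const C => simp only [inst]; rw [hθ C rfl]
  | var y => simp [vars] at hv

end Term

namespace Env

variable {A K : Type*} [DecidableEq K]

/-- Together with `syn_subset_delta` and `delta_closed`, this makes `consts p` the least set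
containing the constants of `p` and closed under definitions, so that the recursion with its memory
`I` need not be reopened. -/
theorem delta_subset (Γ : Env A K) {S : Set K}
    (hS : ∀ C ∈ S, C ∈ Γ.dom → (Γ.body C).syn ⊆ S) (p : Term A K) (I : Finset K) :
    p.syn ⊆ S → (Γ.delta p I : Set K) ⊆ S := by
  induction p, I using delta.induct Γ with
  | case1 | case2 | case8 => intro; simp [delta]
  | case3 I a p ih => simpa [delta, Term.syn] using ih
  | case4 I p q ihp ihq =>
    intro h
    simp only [Term.syn, Set.union_subset_iff] at h
    simp [delta, ihp h.1, ihq h.2]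
  | case5 => intro; simp [delta, *]
  | case6 C I hI hD ih =>
    intro h
    have hC : C ∈ S := h rfl
    rw [delta, dif_neg hI, dif_pos hD, Finset.coe_union, Finset.coe_singleton]
    exact Set.union_subset h (ih (hS C hC hD))
  | case7 C I hI hD =>
    intro h
    rw [delta, dif_neg hI, dif_neg hD, Finset.coe_singleton]
    exact h

theorem syn_subset_delta (Γ : Env A K) (p : Term A K) (I : Finset K) :
    p.syn ⊆ (Γ.delta p I : Set K) ∪ I := by
  induction p, I using delta.induct Γ with
  | case1 | case2 | case8 => simp [Term.syn]
  | case3 I a p ih => simpa [delta, Term.syn] using ih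
  | case4 I p q ihp ihq =>
    intro C hC
    simp only [delta, Finset.coe_union]
    rcases hC with h | h
    · rcases ihp h with h | h <;> simp_all
    · rcases ihq h with h | h <;> simp_all
  | case5 => simp [Term.syn, *]
  | case6 C I hI hD ih => rw [delta, dif_neg hI, dif_pos hD]; simp [Term.syn]
  | case7 C I hI hD => rw [delta, dif_neg hI, dif_neg hD]; simp [Term.syn]

theorem delta_closed (Γ : Env A K) (p : Term A K) (I : Finset K) :
    ∀ D ∈ Γ.delta p I, D ∈ Γ.dom → (Γ.body D).syn ⊆ (Γ.delta p I : Set K) ∪ I := by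
  induction p, I using delta.induct Γ with
  | case1 | case2 | case8 => simp [delta]
  | case3 I a p ih => simpa [delta] using ih
  | case4 I p q ihp ihq =>
    intro D hD hd C hC
    simp only [delta, Finset.coe_union, Finset.mem_union] at hD ⊢
    rcases hD with h | h
    · rcases ihp D h hd hC with h | h <;> simp_all
    · rcases ihq D h hd hC with h | h <;> simp_all
  | case5 => simp [delta, *]
  | case6 C I hI hD ih =>
    intro D hD' hd E hE
    rw [delta, dif_neg hI, dif_pos hD] at hD' ⊢
    -- The recursive call may omit `C` as already known, but `C` is contributed by the singleton in
    -- front of it.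
    have key : E ∈ (Γ.delta (Γ.body C) (insert C I) : Set K) ∪ (insert C I : Finset K) := by
      rcases Finset.mem_union.1 hD' with h | h
      · rw [Finset.mem_singleton.1 h] at hE
        exact syn_subset_delta Γ _ _ hE
      · exact ih D h hd hE
    simp only [Finset.coe_insert, Finset.coe_union, Finset.coe_singleton, Set.mem_union,
      Set.mem_insert_iff, Set.mem_singleton_iff] at key ⊢
    tauto
  | case7 C I hI hD =>
    intro D hD' hd
    rw [delta, dif_neg hI, dif_neg hD, Finset.mem_singleton] at hD'
    exact absurd (hD' ▸ hd) hD

theorem consts_subset (Γ : Env A K) {S : Set K}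
    (hS : ∀ C ∈ S, C ∈ Γ.dom → (Γ.body C).syn ⊆ S) {p : Term A K} (hp : p.syn ⊆ S) :
    (Γ.consts p : Set K) ⊆ S :=
  Γ.delta_subset hS p ∅ hp

theorem syn_subset_consts (Γ : Env A K) (p : Term A K) : p.syn ⊆ Γ.consts p := by
  simpa [consts] using Γ.syn_subset_delta p ∅

theorem consts_closed (Γ : Env A K) {p : Term A K} {D : K} (hD : D ∈ Γ.consts p)
    (hd : D ∈ Γ.dom) : (Γ.body D).syn ⊆ Γ.consts p := by
  simpa [consts] using Γ.delta_closed p ∅ D hD hd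

/-- A set of constants with closed definitions, using constants of the set only. -/
def IsClosedSet (Γ : Env A K) (S : Set K) : Prop :=
  ∀ C ∈ S, C ∈ Γ.dom ∧ (Γ.body C).vars = ∅ ∧ (Γ.body C).syn ⊆ S

/-- Any closed set of constants can serve as a witness, since it contains `consts p`; conversely
`consts p` is one. Stability under subterms, sums and extensions of the environment is then
immediate. -/
theorem isProc_iff (Γ : Env A K) (p : Term A K) :
    Γ.IsProc p ↔ p.IsLegal ∧ p.vars = ∅ ∧ ∃ S, Γ.IsClosedSet S ∧ p.syn ⊆ S := by
  constructor
  · rintro ⟨hl, hc, hv⟩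
    have hv' : ∀ x, x ∉ Γ.fv p := fun x => hv ▸ Set.notMem_empty x
    refine ⟨hl, Set.eq_empty_of_forall_notMem fun x hx => hv' x (Or.inl hx), Γ.consts p,
      fun C hC => ⟨hc hC, Set.eq_empty_of_forall_notMem fun x hx =>
        hv' x (Or.inr ⟨C, hC, hc hC, hx⟩), Γ.consts_closed hC (hc hC)⟩, Γ.syn_subset_consts p⟩
  · rintro ⟨hl, hv, S, hS, hp⟩
    have h := Γ.consts_subset (fun C hC _ => (hS C hC).2.2) hp
    refine ⟨hl, fun C hC => (hS C (h hC)).1, Set.eq_empty_of_forall_notMem ?_⟩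
    rintro x (hx | ⟨C, hC, -, hx⟩)
    · simp [hv] at hx
    · simp [(hS C (h hC)).2.1] at hx

variable {Γ : Env A K} {p q : Term A K} {C : K}

theorem IsProc.legal (h : Γ.IsProc p) : p.IsLegal := h.1

theorem IsProc.vars_eq (h : Γ.IsProc p) : p.vars = ∅ := ((Γ.isProc_iff p).1 h).2.1

theorem IsProc.of_syn (h : Γ.IsProc p) (hl : q.IsLegal) (hv : q.vars = ∅)
    (hs : q.syn ⊆ p.syn) : Γ.IsProc q := by
  obtain ⟨-, -, S, hS, hp⟩ := (Γ.isProc_iff p).1 h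
  exact (Γ.isProc_iff q).2 ⟨hl, hv, S, hS, hs.trans hp⟩

theorem IsProc.const_of_mem (h : Γ.IsProc p) (hC : C ∈ p.syn) : Γ.IsProc (.const C) :=
  h.of_syn (Or.inl trivial) rfl (Set.singleton_subset_iff.2 hC)

theorem IsProc.mem_dom (h : Γ.IsProc (.const C)) : C ∈ Γ.dom := by
  obtain ⟨-, -, S, hS, hp⟩ := (Γ.isProc_iff _).1 h
  exact (hS C (hp rfl)).1

theorem IsProc.body (h : Γ.IsProc (.const C)) : Γ.IsGuardedProc (Γ.body C) := by
  obtain ⟨-, -, S, hS, hp⟩ := (Γ.isProc_iff _).1 h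
  obtain ⟨h1, h2, h3⟩ := hS C (hp rfl)
  have hg := Γ.guarded C h1
  exact ⟨(Γ.isProc_iff _).2 ⟨Or.inr hg, h2, S, hS, h3⟩, hg⟩

theorem IsProc.mono {Δ : Env A K} (hΔ : Δ.Extends Γ) (h : Γ.IsProc p) : Δ.IsProc p := by
  obtain ⟨hl, hv, S, hS, hp⟩ := (Γ.isProc_iff p).1 h
  refine (Δ.isProc_iff p).2 ⟨hl, hv, S, fun C hC => ?_, hp⟩
  obtain ⟨h1, h2, h3⟩ := hS C hC
  obtain ⟨h4, h5⟩ := hΔ C _ ⟨h1, rfl⟩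
  rw [h5]
  exact ⟨h4, h2, h3⟩

theorem IsGuardedProc.mono {Δ : Env A K} (hΔ : Δ.Extends Γ) (h : Γ.IsGuardedProc p) :
    Δ.IsGuardedProc p := ⟨h.1.mono hΔ, h.2⟩

theorem isGuardedProc_zero (Γ : Env A K) : Γ.IsGuardedProc .zero :=
  ⟨(Γ.isProc_iff _).2 ⟨Or.inr trivial, rfl, ∅, fun _ h => h.elim, le_rfl⟩, trivial⟩

theorem isGuardedProc_one (Γ : Env A K) (α : Option A) : Γ.IsGuardedProc (.one α) :=
  ⟨(Γ.isProc_iff _).2 ⟨Or.inr trivial, rfl, ∅, fun _ h => h.elim, le_rfl⟩, trivial⟩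

theorem isGuardedProc_pre (a : A) : Γ.IsGuardedProc (.pre a p) ↔ Γ.IsProc p :=
  ⟨fun h => h.1.of_syn h.2 h.1.vars_eq le_rfl,
    fun h => ⟨h.of_syn (Or.inr h.legal) h.vars_eq le_rfl, h.legal⟩⟩

theorem isGuardedProc_plus :
    Γ.IsGuardedProc (.plus p q) ↔ Γ.IsGuardedProc p ∧ Γ.IsGuardedProc q := by
  constructor
  · rintro ⟨h, hp, hq⟩
    have hv := h.vars_eq
    simp only [Term.vars, Set.union_empty_iff] at hv
    exact ⟨⟨h.of_syn (Or.inr hp) hv.1 Set.subset_union_left, hp⟩,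
      ⟨h.of_syn (Or.inr hq) hv.2 Set.subset_union_right, hq⟩⟩
  · rintro ⟨⟨h, hp⟩, ⟨h', hq⟩⟩
    obtain ⟨-, hv, S, hS, hs⟩ := (Γ.isProc_iff p).1 h
    obtain ⟨-, hv', S', hS', hs'⟩ := (Γ.isProc_iff q).1 h'
    refine ⟨(Γ.isProc_iff _).2 ⟨Or.inr ⟨hp, hq⟩, by simp [Term.vars, hv, hv'], S ∪ S', ?_,
      Set.union_subset_union hs hs'⟩, hp, hq⟩
    rintro C (hC | hC)
    · obtain ⟨h1, h2, h3⟩ := hS C hC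
      exact ⟨h1, h2, h3.trans Set.subset_union_left⟩
    · obtain ⟨h1, h2, h3⟩ := hS' C hC
      exact ⟨h1, h2, h3.trans Set.subset_union_right⟩

end Env
end SFM

/-! ### Summands, derivatives and operational semantics -/

namespace SFM

noncomputable instance {A K : Type*} : DecidableEq (Term A K) := Classical.decEq _

/-- The summands of a guarded term. -/
noncomputable def Term.summands {A K : Type*} : Term A K → Finset (Term A K)
  | .zero => ∅
  | .plus p q => p.summands ∪ q.summands
  | p => {p}

/-- The terms that can be summands of guarded terms. -/
def Term.IsSummand {A K : Type*} : Term A K → Prop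
  | .one _ => True
  | .pre _ _ => True
  | _ => False

namespace Env

variable {A K : Type*} (Γ : Env A K)

/-- Replace a constant by its definition. -/
def unfold : Term A K → Term A K
  | .const C => Γ.body C
  | p => p

open Classical in
/-- The summands of the `a`-derivative of a term that is not a sum. -/
noncomputable def derivAtom (a : A) : Term A K → Finset (Term A K)
  | .one (some b) => if a = b then {.one none} else ∅
  | .pre b p => if a = b then (Γ.unfold p).summands else ∅
  | _ => ∅

/-- The `a`-derivative of a sum, given by its set of summands. -/
noncomputable def derivSet (S : Finset (Term A K)) (a : A) : Finset (Term A K) :=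
  S.biUnion (Γ.derivAtom a)

/-- The words accepted from a set of summands. -/
def Accepts (S : Finset (Term A K)) (w : List A) : Prop :=
  .one none ∈ w.foldl Γ.derivSet S

/-- The structural operational semantics. -/
inductive Step : Term A K → Option A → State A K → Prop
  | one (α : Option A) : Step (.one α) α .final
  | pre (a : A) (p : Term A K) : Step (.pre a p) (some a) (.proc p)
  | left {p : Term A K} {α : Option A} {r : State A K} (q : Term A K) (h : Step p α r) :
      Step (.plus p q) α r
  | right (p : Term A K) {q : Term A K} {α : Option A} {r : State A K} (h : Step q α r) :
      Step (.plus p q) α r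
  | const {C : K} {α : Option A} {r : State A K} (hC : C ∈ Γ.dom) (h : Step (Γ.body C) α r) :
      Step (.const C) α r

variable {Γ}

theorem Step.eq_final {p : Term A K} {r : State A K} (h : Γ.Step p none r) : r = .final := by
  generalize hα : (none : Option A) = α at h
  induction h with
  | one => rfl
  | pre => cases hα
  | left _ _ ih => exact ih hα
  | right _ _ ih => exact ih hα
  | const _ _ ih => exact ih hα

theorem Step.of_summand {p t : Term A K} {α : Option A} {r : State A K} (h : Γ.Step t α r)
    (ht : t ∈ p.summands) : Γ.Step p α r := by
  induction p with
  | zero => simp [Term.summands] at ht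
  | plus p q ihp ihq =>
    rcases Finset.mem_union.1 ht with ht | ht
    · exact .left q (ihp ht)
    · exact .right p (ihq ht)
  | _ => rwa [← Finset.mem_singleton.1 ht]

/-- A guarded term is not a constant, so its steps can be read off its summands without consulting
definitions. -/
theorem exists_summand_of_guarded {p : Term A K} {α : Option A} {r : State A K}
    (h : Γ.Step p α r) (hp : p.IsGuarded) :
    (α = none ∧ r = .final ∧ .one none ∈ p.summands) ∨
    ∃ a, α = some a ∧ ((r = .final ∧ .one (some a) ∈ p.summands) ∨
      ∃ q, r = .proc q ∧ .pre a q ∈ p.summands) := by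
  induction h with
  | one α => cases α <;> simp [Term.summands]
  | pre => simp [Term.summands]
  | left _ _ ih => have := ih hp.1; simp only [Term.summands, Finset.mem_union]; grind
  | right _ _ ih => have := ih hp.2; simp only [Term.summands, Finset.mem_union]; grind
  | const => exact hp.elim

theorem Step.unfold {p : Term A K} {α : Option A} {r : State A K} (h : Γ.Step p α r) :
    Γ.Step (Γ.unfold p) α r := by
  cases h with
  | const hC h => exact h
  | one => exact .one _
  | pre => exact .pre _ _
  | left _ h => exact .left _ h
  | right _ h => exact .right _ h

theorem guarded_of_mem_summands {p t : Term A K} (hp : p.IsGuarded) (ht : t ∈ p.summands) :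
    t.IsGuarded := by
  induction p with
  | zero => simp [Term.summands] at ht
  | plus p q ihp ihq => exact (Finset.mem_union.1 ht).elim (ihp hp.1) (ihq hp.2)
  | _ => rwa [Finset.mem_singleton.1 ht]

theorem isSummand_of_mem_summands {p t : Term A K} (hp : p.IsGuarded) (ht : t ∈ p.summands) :
    t.IsSummand := by
  induction p with
  | zero => simp [Term.summands] at ht
  | plus p q ihp ihq => exact (Finset.mem_union.1 ht).elim (ihp hp.1) (ihq hp.2)
  | one | pre => rw [Finset.mem_singleton.1 ht]; trivial
  | _ => exact hp.elim

theorem Step.guarded_unfold {t : Term A K} {α : Option A} {r : State A K} (h : Γ.Step t α r)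
    (hl : t.IsLegal) : (Γ.unfold t).IsGuarded := by
  cases h with
  | const hC => exact Γ.guarded _ hC
  | _ => exact hl.resolve_left id

theorem foldl_derivSet_mono {S : Finset (Term A K)} {σ : List A} {a : A} {s : Term A K}
    (hs : s ∈ σ.foldl Γ.derivSet S) :
    Γ.derivAtom a s ⊆ (σ ++ [a]).foldl Γ.derivSet S := by
  intro t ht
  rw [List.foldl_append]
  exact Finset.mem_biUnion.2 ⟨s, hs, ht⟩

theorem mem_trimT_of_ne {S : Type*} {N : Automaton A S} {t : S × Option A × S} (h : t ∈ N.T)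
    (hne : t.1 ≠ N.q₀) : t ∈ N.trimT := by
  unfold Automaton.trimT
  split_ifs
  · exact h
  · exact ⟨h, hne⟩

theorem trimT_subset {S : Type*} (N : Automaton A S) : N.trimT ⊆ N.T := by
  unfold Automaton.trimT
  split_ifs
  · exact le_rfl
  · exact Set.sdiff_subset

theorem mem_trimT_of_reached {S : Type*} {N : Automaton A S} {t : S × Option A × S} {q : S} {a : A}
    (h : t ∈ N.T) (hr : (q, some a, t.1) ∈ N.T) : t ∈ N.trimT := by
  by_cases hne : t.1 = N.q₀
  · unfold Automaton.trimT
    rw [if_pos ⟨q, a, hne ▸ hr⟩]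
    exact h
  · exact mem_trimT_of_ne h hne

/-! ### The automaton of a process agrees with the operational semantics and with derivatives -/

variable [DecidableEq K]

theorem den_q₀ (p : Term A K) (I : Finset K) : (Γ.den p I).q₀ = .proc p := by
  cases p <;> rw [den] <;> try rfl
  split_ifs <;> rfl

theorem den_q₀_mem (p : Term A K) (I : Finset K) : .proc p ∈ (Γ.den p I).Q := by
  cases p <;> rw [den] <;> try simp [deadlock]
  split_ifs <;> simp

theorem step_of_mem_den (p : Term A K) (I : Finset K) : ∀ t ∈ (Γ.den p I).T,
    ∃ q, t.1 = .proc q ∧ Γ.Step q t.2.1 t.2.2 := by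
  induction p, I using den.induct Γ with
  | case1 => simp [den, deadlock]
  | case2 α I => rw [den]; rintro t rfl; exact ⟨_, rfl, .one α⟩
  | case3 a p I ih =>
    rw [den]
    rintro t (rfl | ht)
    · exact ⟨_, rfl, .pre a p⟩
    · exact ih t ht
  | case4 p q I ihp ihq =>
    rw [den]
    rintro t ((⟨α, r, rfl, h | h⟩ | ht) | ht)
    · obtain ⟨_, h1, h2⟩ := ihp _ h
      cases h1
      exact ⟨_, rfl, .left _ h2⟩
    · obtain ⟨_, h1, h2⟩ := ihq _ h
      cases h1
      exact ⟨_, rfl, .right _ h2⟩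
    · exact ihp t (trimT_subset _ ht)
    · exact ihq t (trimT_subset _ ht)
  | case5 C I h ih =>
    rw [den, dif_pos h]
    rintro t (⟨α, r, rfl, h'⟩ | ht)
    · obtain ⟨_, h1, h2⟩ := ih _ h'
      cases h1
      exact ⟨_, rfl, .const h.1 h2⟩
    · exact ih t (trimT_subset _ ht)
  | case6 C I h => rw [den, dif_neg h]; simp [deadlock]
  | case7 => simp [den, deadlock]

theorem mem_den_of_step_guarded {p : Term A K} (hp : p.IsGuarded) (I : Finset K) {α : Option A}
    {r : State A K} (h : Γ.Step p α r) : (.proc p, α, r) ∈ (Γ.den p I).T := by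
  induction h with
  | one α => simp [den]
  | pre a p => simp [den]
  | left q _ ih => rw [den]; exact Or.inl (Or.inl ⟨_, _, rfl, Or.inl (ih hp.1)⟩)
  | right q _ ih => rw [den]; exact Or.inl (Or.inl ⟨_, _, rfl, Or.inr (ih hp.2)⟩)
  | const => exact hp.elim

theorem mem_den_of_step {p : Term A K} (I : Finset K) (hp : ∀ C ∈ I, p ≠ .const C)
    (hl : p.IsLegal) {α : Option A} {r : State A K} (h : Γ.Step p α r) :
    (.proc p, α, r) ∈ (Γ.den p I).T := by
  rcases hl with hl | hl
  · cases h with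
    | const hC h =>
      rename_i C
      have hC' : C ∈ Γ.dom ∧ C ∉ I := ⟨hC, fun hI => hp C hI rfl⟩
      rw [den, dif_pos hC']
      exact Or.inl ⟨_, _, rfl, mem_den_of_step_guarded (Γ.guarded C hC) _ h⟩
    | _ => exact hl.elim
  · exact mem_den_of_step_guarded hl I h

/-- Trimming never harms a process that is the target of a transition: an `ε`-transition leads only
to the final state, so the incoming transition has a letter, and this is just what prevents removal.
-/
theorem mem_trimT_den {p t : Term A K} {I : Finset K} {q : State A K} {α β : Option A}
    {r : State A K} (h : (.proc t, α, r) ∈ (Γ.den p I).T)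
    (hr : (q, β, .proc t) ∈ (Γ.den p I).T) : (.proc t, α, r) ∈ (Γ.den p I).trimT := by
  cases β with
  | none =>
    obtain ⟨_, -, h'⟩ := step_of_mem_den _ _ _ hr
    cases h'.eq_final
  | some a => exact mem_trimT_of_reached h hr

/-- In `den p I`, the states reached by a transition have all their transitions, except for the
constants in `I`. -/
theorem mem_den_of_target (p : Term A K) (I : Finset K) (hl : p.IsLegal) :
    ∀ q β t, (q, β, .proc t) ∈ (Γ.den p I).T → (∃ C ∈ I, t = .const C) ∨
      ∀ α r, Γ.Step t α r → (.proc t, α, r) ∈ (Γ.den p I).T := by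
  induction p, I using den.induct Γ with
  | case1 => simp [den, deadlock]
  | case2 => simp [den]
  | case3 a p I ih =>
    intro q β t h
    rw [den] at h ⊢
    rcases h with h | h
    · simp only [Set.mem_singleton_iff, Prod.mk.injEq, State.proc.injEq] at h
      obtain ⟨-, -, rfl⟩ := h
      by_cases hC : ∃ C ∈ I, t = .const C
      · exact Or.inl hC
      · push Not at hC
        exact Or.inr fun α r hs => Or.inr (mem_den_of_step I hC (hl.resolve_left id) hs)
    · exact (ih (hl.resolve_left id) q β t h).imp_right fun h' α r hs => Or.inr (h' α r hs)
  | case4 p₁ p₂ I ih₁ ih₂ =>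
    have hl' : (Term.plus p₁ p₂).IsGuarded := hl.resolve_left id
    have key₁ : ∀ q β t, (q, β, .proc t) ∈ (Γ.den p₁ I).T → (∃ C ∈ I, t = .const C) ∨
        ∀ α r, Γ.Step t α r → (.proc t, α, r) ∈ (Γ.den p₁ I).trimT := fun q β t h =>
      (ih₁ (Or.inr hl'.1) q β t h).imp_right fun h' α r hs => mem_trimT_den (h' α r hs) h
    have key₂ : ∀ q β t, (q, β, .proc t) ∈ (Γ.den p₂ I).T → (∃ C ∈ I, t = .const C) ∨
        ∀ α r, Γ.Step t α r → (.proc t, α, r) ∈ (Γ.den p₂ I).trimT := fun q β t h =>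
      (ih₂ (Or.inr hl'.2) q β t h).imp_right fun h' α r hs => mem_trimT_den (h' α r hs) h
    intro q β t h
    rw [den] at h ⊢
    have h : (∃ q, (q, β, .proc t) ∈ (Γ.den p₁ I).T) ∨ ∃ q, (q, β, .proc t) ∈ (Γ.den p₂ I).T := by
      rcases h with (⟨α, r, h1, h2⟩ | h) | h
      · simp only [Prod.mk.injEq] at h1
        obtain ⟨-, rfl, rfl⟩ := h1
        exact h2.imp (⟨_, ·⟩) (⟨_, ·⟩)
      · exact Or.inl ⟨_, trimT_subset _ h⟩
      · exact Or.inr ⟨_, trimT_subset _ h⟩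
    rcases h with ⟨q, h⟩ | ⟨q, h⟩
    · exact (key₁ q β t h).imp_right fun h' α r hs => Or.inl (Or.inr (h' α r hs))
    · exact (key₂ q β t h).imp_right fun h' α r hs => Or.inr (h' α r hs)
  | case5 C I h ih =>
    have hg := Γ.guarded C h.1
    intro q β t ht
    rw [den, dif_pos h] at ht ⊢
    have ht : ∃ q, (q, β, .proc t) ∈ (Γ.den (Γ.body C) (insert C I)).T := by
      rcases ht with ⟨α, r, h1, h2⟩ | ht
      · simp only [Prod.mk.injEq] at h1
        obtain ⟨-, rfl, rfl⟩ := h1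
        exact ⟨_, h2⟩
      · exact ⟨_, trimT_subset _ ht⟩
    obtain ⟨q, ht⟩ := ht
    rcases ih (Or.inr hg) q β t ht with ⟨D, hD, rfl⟩ | h'
    -- Inside the automaton of its own body, `C` is stuck; the new initial state `C` supplies its
    -- transitions.
    · rcases Finset.mem_insert.1 hD with rfl | hD
      · refine Or.inr fun α r hs => Or.inl ⟨_, _, rfl, ?_⟩
        exact mem_den_of_step_guarded hg _ hs.unfold
      · exact Or.inl ⟨D, hD, rfl⟩
    · exact Or.inr fun α r hs => Or.inr (mem_trimT_den (h' α r hs) ht)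
  | case6 C I h => rw [den, dif_neg h]; simp [deadlock]
  | case7 => simp [den, deadlock]

theorem den_F_subset (p : Term A K) (I : Finset K) : (Γ.den p I).F ⊆ {.final} := by
  induction p, I using den.induct Γ with
  | case1 | case2 | case7 => simp [den, deadlock]
  | case3 a p I ih => rw [den]; exact ih
  | case4 p q I ihp ihq => rw [den]; exact Set.union_subset ihp ihq
  | case5 C I h ih => rw [den, dif_pos h]; exact ih
  | case6 C I h => rw [den, dif_neg h]; simp [deadlock]

theorem final_mem_den (p : Term A K) (I : Finset K) :
    ∀ q β, (q, β, .final) ∈ (Γ.den p I).T → .final ∈ (Γ.den p I).F := by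
  induction p, I using den.induct Γ with
  | case1 | case2 | case7 => simp [den, deadlock]
  | case3 a p I ih =>
    rw [den]
    rintro q β (h | h)
    · simp at h
    · exact ih q β h
  | case4 p₁ p₂ I ih₁ ih₂ =>
    rw [den]
    rintro q β ((⟨α, r, h1, h | h⟩ | h) | h)
    · cases h1; exact Or.inl (ih₁ _ _ h)
    · cases h1; exact Or.inr (ih₂ _ _ h)
    · exact Or.inl (ih₁ _ _ (trimT_subset _ h))
    · exact Or.inr (ih₂ _ _ (trimT_subset _ h))
  | case5 C I h ih =>
    rw [den, dif_pos h]
    rintro q β (⟨α, r, h1, h'⟩ | h')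
    · cases h1; exact ih _ _ h'
    · exact ih _ _ (trimT_subset _ h')
  | case6 C I h => rw [den, dif_neg h]; simp [deadlock]

/-- With nothing known initially, the exception in `mem_den_of_target` is void. A reached process is
either the initial state or the target of a transition. -/
theorem step_iff_mem_den {p : Term A K} (hl : p.IsLegal) {σ : List A} {t : Term A K}
    (h : (Γ.den p ∅).Reach (.proc p) σ (.proc t)) {α : Option A} {r : State A K} :
    (.proc t, α, r) ∈ (Γ.den p ∅).T ↔ Γ.Step t α r := by
  constructor
  · intro h
    obtain ⟨_, h1, h2⟩ := step_of_mem_den _ _ _ h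
    cases h1
    exact h2
  · have key : ∀ q β, (q, β, .proc t) ∈ (Γ.den p ∅).T → Γ.Step t α r →
        (.proc t, α, r) ∈ (Γ.den p ∅).T := fun q β h hs =>
      (mem_den_of_target p ∅ hl q β t h).elim (by simp) fun h' => h' α r hs
    cases h with
    | refl => exact mem_den_of_step ∅ (by simp) hl
    | single _ _ h => exact key _ _ h
    | tail _ _ _ _ _ h => exact key _ _ h

theorem reach_induction {p : Term A K} (hl : p.IsLegal) {P : List A → State A K → Prop}
    (base : P [] (.proc p))
    (step : ∀ σ t α r, (Γ.den p ∅).Reach (.proc p) σ (.proc t) → P σ (.proc t) → Γ.Step t α r →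
      P (σ ++ α.toList) r)
    {σ : List A} {r : State A K} (h : (Γ.den p ∅).Reach (.proc p) σ r) : P σ r := by
  have hrefl : (Γ.den p ∅).Reach (.proc p) [] (.proc p) := .refl _ (Or.inl (den_q₀_mem p ∅))
  generalize hq : State.proc p = q at h
  induction h with
  | refl => exact hq ▸ base
  | single α r h =>
    subst hq
    exact step [] p α r hrefl base ((step_iff_mem_den hl hrefl).1 h)
  | tail σ q' α r h h' ih =>
    subst hq
    obtain ⟨t, ht, hs⟩ := step_of_mem_den _ _ _ h'
    simp only at ht
    subst ht
    exact step σ t α r h ih hs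

theorem legal_of_reach {p : Term A K} (hl : p.IsLegal) {σ : List A} {t : Term A K}
    (h : (Γ.den p ∅).Reach (.proc p) σ (.proc t)) : t.IsLegal := by
  refine reach_induction (P := fun _ r => ∀ t, r = .proc t → t.IsLegal) hl ?_ ?_ h t rfl
  · rintro t ⟨⟩
    exact hl
  · rintro σ t α r - ih hs u rfl
    have hg := hs.guarded_unfold (ih t rfl)
    rcases exists_summand_of_guarded hs.unfold hg with
      ⟨-, h, -⟩ | ⟨a, -, ⟨h, -⟩ | ⟨q, h, hq⟩⟩
    · cases h
    · cases h
    · cases h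
      exact guarded_of_mem_summands hg hq

/-- Soundness of the subset construction: each process reached by `σ` contributes its summands to
the `σ`-derivative. The final state is reached either by `ε` from `ε.1`, or by `a` from `a.1`, whose
derivative is `ε.1`. -/
theorem mem_foldl_derivSet_of_reach {p : Term A K} (hl : p.IsLegal) {σ : List A} {r : State A K}
    (h : (Γ.den p ∅).Reach (.proc p) σ r) :
    (∀ t, r = .proc t → (Γ.unfold t).summands ⊆ σ.foldl Γ.derivSet (Γ.unfold p).summands) ∧
    (r = .final → Γ.Accepts (Γ.unfold p).summands σ) := by
  refine reach_induction (P := fun σ r =>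
    (∀ t, r = .proc t → (Γ.unfold t).summands ⊆ σ.foldl Γ.derivSet (Γ.unfold p).summands) ∧
    (r = .final → Γ.Accepts (Γ.unfold p).summands σ)) hl ?_ ?_ h
  · refine ⟨?_, fun h => by cases h⟩
    rintro t ⟨⟩
    exact Finset.Subset.refl _
  · rintro σ t α r hr ⟨ih, -⟩ hs
    have hg := hs.guarded_unfold (legal_of_reach hl hr)
    rcases exists_summand_of_guarded hs.unfold hg with
      ⟨rfl, rfl, hm⟩ | ⟨a, rfl, ⟨rfl, hm⟩ | ⟨q, rfl, hm⟩⟩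
    · refine ⟨by rintro _ ⟨⟩, fun _ => ?_⟩
      simpa [Accepts] using ih t rfl hm
    · refine ⟨by rintro _ ⟨⟩, fun _ => ?_⟩
      exact foldl_derivSet_mono (ih t rfl hm) (by simp [derivAtom])
    · refine ⟨?_, by rintro ⟨⟩⟩
      rintro _ ⟨⟩
      refine fun u hu => foldl_derivSet_mono (ih t rfl hm) ?_
      simpa [derivAtom] using hu

theorem step_of_step_unfold {t : Term A K} (ht : Γ.IsProc t) {α : Option A} {r : State A K}
    (h : Γ.Step (Γ.unfold t) α r) : Γ.Step t α r := by
  cases t with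
  | const C => exact .const ht.mem_dom h
  | _ => exact h

theorem isGuardedProc_unfold {t : Term A K} (ht : Γ.IsProc t) : Γ.IsGuardedProc (Γ.unfold t) := by
  cases t with
  | const C => exact ht.body
  | var x => exact absurd ht.vars_eq (by simp [Term.vars])
  | _ => exact ⟨ht, ht.legal.resolve_left id⟩

theorem isGuardedProc_of_mem_summands {p t : Term A K} (hp : Γ.IsGuardedProc p)
    (ht : t ∈ p.summands) : Γ.IsGuardedProc t := by
  induction p with
  | zero => simp [Term.summands] at ht
  | plus p q ihp ihq =>
    rw [isGuardedProc_plus] at hp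
    exact (Finset.mem_union.1 ht).elim (ihp hp.1) (ihq hp.2)
  | _ => rwa [Finset.mem_singleton.1 ht]

/-- The second alternative is needed because the derivative of `a.1` is the summand `ε.1`, whereas
the automaton goes directly to the final state, with no process in between. -/
theorem reach_of_mem_foldl_derivSet {p : Term A K} (hp : Γ.IsProc p) (σ : List A) :
    ∀ s ∈ σ.foldl Γ.derivSet (Γ.unfold p).summands,
      (∃ t, Γ.IsProc t ∧ (Γ.den p ∅).Reach (.proc p) σ (.proc t) ∧ s ∈ (Γ.unfold t).summands) ∨
      (s = .one none ∧ (Γ.den p ∅).Reach (.proc p) σ .final) := by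
  induction σ using List.reverseRecOn with
  | nil => exact fun s hs => Or.inl ⟨p, hp, .refl _ (Or.inl (den_q₀_mem p ∅)), hs⟩
  | append_singleton σ a ih =>
    intro s hs
    rw [List.foldl_append] at hs
    obtain ⟨u, hu, hs⟩ := Finset.mem_biUnion.1 hs
    rcases ih u hu with ⟨t, ht, hr, hut⟩ | ⟨rfl, -⟩
    · have tail : ∀ r, Γ.Step u (some a) r → (Γ.den p ∅).Reach (.proc p) (σ ++ [a]) r :=
        fun r h => .tail _ σ _ (some a) r hr ((step_iff_mem_den hp.legal hr).2
          (step_of_step_unfold ht (h.of_summand hut)))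
      have hup := isGuardedProc_of_mem_summands (isGuardedProc_unfold ht) hut
      cases u with
      | one α =>
        cases α with
        | none => simp [derivAtom] at hs
        | some b =>
          by_cases hab : a = b
          · subst hab
            exact Or.inr ⟨by simpa [derivAtom] using hs, tail _ (.one _)⟩
          · simp [derivAtom, hab] at hs
      | pre b q =>
        by_cases hab : a = b
        · subst hab
          exact Or.inl ⟨q, (isGuardedProc_pre a).1 hup, tail _ (.pre _ _),
            by simpa [derivAtom] using hs⟩
        · simp [derivAtom, hab] at hs
      | _ => simp [derivAtom] at hs
    · simp [derivAtom] at hs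

theorem mem_lang_iff {p : Term A K} (hp : Γ.IsProc p) (σ : List A) :
    σ ∈ Γ.lang p ↔ Γ.Accepts (Γ.unfold p).summands σ := by
  constructor
  · rintro ⟨f, hf, h⟩
    rw [den_q₀] at h
    exact (mem_foldl_derivSet_of_reach hp.legal h).2 (den_F_subset _ _ hf)
  · intro h
    have hr : (Γ.den p ∅).Reach (.proc p) σ .final := by
      rcases reach_of_mem_foldl_derivSet hp σ _ h with ⟨t, ht, hr, hm⟩ | ⟨-, hr⟩
      · have := Automaton.Reach.tail _ σ _ none _ hr ((step_iff_mem_den hp.legal hr).2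
          (step_of_step_unfold ht ((Step.one none).of_summand hm)))
        simpa using this
      · exact hr
    refine ⟨.final, ?_, by rwa [den_q₀]⟩
    cases hr with
    | single _ _ h => exact final_mem_den _ _ _ _ h
    | tail _ _ _ _ _ h => exact final_mem_den _ _ _ _ h

end Env
end SFM

/-! ### The semilattice of guarded processes modulo provable equality -/

namespace SFM
namespace Env

variable {A K : Type*} [DecidableEq K]

/-- Derivable equality of guarded processes. -/
def derivSetoid (Γ : Env A K) : Setoid {p // Γ.IsGuardedProc p} where
  r p q := Γ.Deriv p.1 q.1
  iseqv := ⟨fun p => .refl p.2.1, .symm, .trans⟩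

/-- Guarded processes up to derivable equality. -/
def Cls (Γ : Env A K) : Type _ := Quotient Γ.derivSetoid

namespace Cls

variable {Γ : Env A K}

/-- The class of a guarded process, given with a proof. -/
def mk : {p // Γ.IsGuardedProc p} → Cls Γ := Quotient.mk _

/-- The sum of two classes. -/
protected def sup : Cls Γ → Cls Γ → Cls Γ :=
  Quotient.map₂ (fun p q => ⟨.plus p.1 q.1, isGuardedProc_plus.2 ⟨p.2, q.2⟩⟩)
    fun p p' h q q' h' => .congr_plus p.2.2 p'.2.2 q.2.2 q'.2.2 h h'

instance : Max (Cls Γ) := ⟨Cls.sup⟩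

/-- A2, A1 and A4 are the semilattice laws, and A3 makes `0` the bottom. Sums over finite sets
thereby become suprema, independent of order and multiplicity. -/
instance : SemilatticeSup (Cls Γ) :=
  SemilatticeSup.mk'
    (by rintro ⟨p⟩ ⟨q⟩; exact Quotient.sound (.A2 p.2 q.2))
    (by rintro ⟨p⟩ ⟨q⟩ ⟨r⟩; exact Quotient.sound (.symm (.A1 p.2 q.2 r.2)))
    (by rintro ⟨p⟩; exact Quotient.sound (.A4 p.2))

instance : OrderBot (Cls Γ) where
  bot := mk ⟨.zero, Γ.isGuardedProc_zero⟩
  bot_le := by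
    rintro ⟨p⟩
    exact sup_eq_right.1 (Quotient.sound (.trans (.A2 Γ.isGuardedProc_zero p.2) (.A3 p.2)))

/-- Prefixing preserves sums. -/
def pre (Γ : Env A K) (a : A) : SupBotHom (Cls Γ) (Cls Γ) where
  toFun := Quotient.map (fun p => ⟨.pre a p.1, (isGuardedProc_pre a).2 p.2.1⟩)
    fun _ _ h => .congr_pre a h
  map_sup' := by rintro ⟨p⟩ ⟨q⟩; exact Quotient.sound (.T2 a p.2 q.2)
  map_bot' := Quotient.sound (.T1 a)

end Cls

open Classical in
/-- The class of a guarded process. -/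
noncomputable def cls (Γ : Env A K) (p : Term A K) : Cls Γ :=
  -- The default `⊥` makes `cls` total, so that suprema over finite sets of raw terms make sense.
  if h : Γ.IsGuardedProc p then Cls.mk ⟨p, h⟩ else ⊥

variable {Γ Δ : Env A K} {p q : Term A K}

theorem cls_eq_mk (hp : Γ.IsGuardedProc p) : Γ.cls p = Cls.mk ⟨p, hp⟩ := dif_pos hp

theorem cls_eq_iff (hp : Γ.IsGuardedProc p) (hq : Γ.IsGuardedProc q) :
    Γ.cls p = Γ.cls q ↔ Γ.Deriv p q := by
  rw [cls_eq_mk hp, cls_eq_mk hq]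
  exact Quotient.eq

theorem cls_zero : Γ.cls .zero = ⊥ := by
  rw [cls_eq_mk Γ.isGuardedProc_zero]
  rfl

theorem cls_plus (hp : Γ.IsGuardedProc p) (hq : Γ.IsGuardedProc q) :
    Γ.cls (.plus p q) = Γ.cls p ⊔ Γ.cls q := by
  rw [cls_eq_mk hp, cls_eq_mk hq, cls_eq_mk (isGuardedProc_plus.2 ⟨hp, hq⟩)]
  rfl

theorem cls_pre (a : A) (hp : Γ.IsGuardedProc p) : Γ.cls (.pre a p) = Cls.pre Γ a (Γ.cls p) := by
  rw [cls_eq_mk hp, cls_eq_mk ((isGuardedProc_pre a).2 hp.1)]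
  rfl

theorem cls_one_some (a : A) : Γ.cls (.one (some a)) = Cls.pre Γ a (Γ.cls (.one none)) := by
  rw [← cls_pre a (Γ.isGuardedProc_one _), cls_eq_iff (Γ.isGuardedProc_one _)
    ((isGuardedProc_pre a).2 (Γ.isGuardedProc_one _).1)]
  exact .symm (.T3 a)

theorem cls_eq_sup_summands (hp : Γ.IsGuardedProc p) : Γ.cls p = p.summands.sup Γ.cls := by
  induction p with
  | zero => simp [Term.summands, cls_zero]
  | plus p q ihp ihq =>
    rw [isGuardedProc_plus] at hp
    rw [cls_plus hp.1 hp.2, ihp hp.1, ihq hp.2, Term.summands, Finset.sup_union]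
  | _ => simp [Term.summands]

theorem deriv_unfold (hΔ : Δ.Extends Γ) (hp : Γ.IsProc p) : Δ.Deriv p (Γ.unfold p) := by
  cases p with
  | const C => exact .R1 (hp.mono hΔ) (hΔ C _ ⟨hp.mem_dom, rfl⟩)
  | _ => exact .refl (hp.mono hΔ)

theorem cls_pre_unfold (hΔ : Δ.Extends Γ) (a : A) (hp : Γ.IsProc p) :
    Δ.cls (.pre a p) = Cls.pre Δ a ((Γ.unfold p).summands.sup Δ.cls) := by
  have hu := (isGuardedProc_unfold hp).mono hΔ
  rw [← cls_eq_sup_summands hu, ← cls_pre a hu, cls_eq_iff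
    ((isGuardedProc_pre a).2 (hp.mono hΔ)) ((isGuardedProc_pre a).2 hu.1)]
  exact .congr_pre a (deriv_unfold hΔ hp)

/-- The sum of a list of terms. -/
def sumList : List (Term A K) → Term A K := List.foldr .plus .zero

theorem isGuardedProc_sumList {l : List (Term A K)} (h : ∀ p ∈ l, Γ.IsGuardedProc p) :
    Γ.IsGuardedProc (sumList l) := by
  induction l with
  | nil => exact Γ.isGuardedProc_zero
  | cons p l ih =>
    simp only [List.forall_mem_cons] at h
    exact isGuardedProc_plus.2 ⟨h.1, ih h.2⟩

theorem cls_sumList {l : List (Term A K)} (h : ∀ p ∈ l, Γ.IsGuardedProc p) :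
    Γ.cls (sumList l) = (l.map Γ.cls).foldr (· ⊔ ·) ⊥ := by
  induction l with
  | nil => exact cls_zero
  | cons p l ih =>
    simp only [List.forall_mem_cons] at h
    rw [List.map_cons, List.foldr_cons, ← ih h.2]
    exact cls_plus h.1 (isGuardedProc_sumList h.2)

theorem foldr_sup_toList {ι L : Type*} [SemilatticeSup L] [OrderBot L] (s : Finset ι) (f : ι → L) :
    (s.toList.map f).foldr (· ⊔ ·) ⊥ = s.sup f := by
  rw [Finset.sup_def, ← Multiset.sup_coe, ← Multiset.map_coe, Finset.coe_toList]

theorem cls_sumList_toList {S : Finset (Term A K)} (h : ∀ p ∈ S, Γ.IsGuardedProc p) :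
    Γ.cls (sumList S.toList) = S.sup Γ.cls := by
  rw [cls_sumList fun p hp => h p (Finset.mem_toList.1 hp), foldr_sup_toList]

/-- The observable part of a state. -/
def output (b : Bool) : Term A K := if b then .one none else .zero

theorem isGuardedProc_output (b : Bool) : Γ.IsGuardedProc (output b) := by
  unfold output
  split
  · exact Γ.isGuardedProc_one _
  · exact Γ.isGuardedProc_zero

/-- The right-hand side `∑ a, a.(Y a) + o` of an equation of a deterministic system. -/
noncomputable def node [Fintype A] (Y : A → Term A K) (b : Bool) : Term A K :=
  .plus (sumList (Finset.univ.toList.map fun a => .pre a (Y a))) (output b)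

theorem isGuardedProc_node [Fintype A] {Y : A → Term A K} (hY : ∀ a, Γ.IsProc (Y a)) (b : Bool) :
    Γ.IsGuardedProc (node Y b) := by
  refine isGuardedProc_plus.2 ⟨isGuardedProc_sumList ?_, isGuardedProc_output b⟩
  simp only [List.mem_map]
  rintro _ ⟨a, -, rfl⟩
  exact (isGuardedProc_pre a).2 (hY a)

theorem cls_node [Fintype A] {Y : A → Term A K} (hY : ∀ a, Γ.IsProc (Y a)) (b : Bool) :
    Γ.cls (node Y b) = (Finset.univ.sup fun a => Γ.cls (.pre a (Y a))) ⊔ Γ.cls (output b) := by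
  have h : ∀ p ∈ (Finset.univ.toList.map fun a => Term.pre a (Y a)), Γ.IsGuardedProc p := by
    simp only [List.mem_map]
    rintro _ ⟨a, -, rfl⟩
    exact (isGuardedProc_pre a).2 (hY a)
  rw [node, cls_plus (isGuardedProc_sumList h) (isGuardedProc_output b), cls_sumList h,
    List.map_map, foldr_sup_toList]
  rfl

theorem cls_pre_congr (a : A) (hp : Γ.IsProc p) (hq : Γ.IsProc q) (h : Γ.Deriv p q) :
    Γ.cls (.pre a p) = Γ.cls (.pre a q) :=
  (cls_eq_iff ((isGuardedProc_pre a).2 hp) ((isGuardedProc_pre a).2 hq)).2 (.congr_pre a h)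

theorem deriv_node [Fintype A] {Y Z : A → Term A K} (hY : ∀ a, Γ.IsProc (Y a))
    (hZ : ∀ a, Γ.IsProc (Z a)) (h : ∀ a, Γ.Deriv (Y a) (Z a)) (b : Bool) :
    Γ.Deriv (node Y b) (node Z b) := by
  rw [← cls_eq_iff (isGuardedProc_node hY b) (isGuardedProc_node hZ b), cls_node hY, cls_node hZ]
  simp only [cls_pre_congr _ (hY _) (hZ _) (h _)]

theorem isGuardedProc_derivAtom {s : Term A K} (hs : Γ.IsGuardedProc s) (a : A) :
    ∀ t ∈ Γ.derivAtom a s, Γ.IsGuardedProc t := by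
  cases s with
  | one α =>
    cases α with
    | none => simp [derivAtom]
    | some b =>
      intro t ht
      simp only [derivAtom] at ht
      split at ht
      · rw [Finset.mem_singleton.1 ht]
        exact Γ.isGuardedProc_one _
      · simp at ht
  | pre b p =>
    intro t ht
    simp only [derivAtom] at ht
    split at ht
    · exact isGuardedProc_of_mem_summands
        (isGuardedProc_unfold ((isGuardedProc_pre b).1 hs)) ht
    · simp at ht
  | _ => simp [derivAtom]

-- A single summand is the sum of its prefixed derivatives and its output: T3 is used for `a.1`, and
-- R1 for `a.C`, whose derivative consists of the summands of the definition of `C`.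
open Classical in
theorem cls_atom [Fintype A] (hΔ : Δ.Extends Γ) {s : Term A K} (hs : Γ.IsGuardedProc s)
    (hs' : s.IsSummand) :
    Δ.cls s = (Finset.univ.sup fun a => Cls.pre Δ a ((Γ.derivAtom a s).sup Δ.cls)) ⊔
      Δ.cls (output (s = .one none)) := by
  have sup_ite : ∀ (b : A) (S : Finset (Term A K)), (Finset.univ.sup fun a =>
      Cls.pre Δ a ((if a = b then S else ∅).sup Δ.cls)) = Cls.pre Δ b (S.sup Δ.cls) := by
    intro b S
    refine le_antisymm (Finset.sup_le fun a _ => ?_) ?_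
    · split_ifs with h
      · rw [h]
      · simp
    · have := Finset.le_sup (f := fun a => Cls.pre Δ a ((if a = b then S else ∅).sup Δ.cls))
        (Finset.mem_univ b)
      simpa using this
  cases s with
  | one α =>
    cases α with
    | none => simp [derivAtom, output]
    | some b => simp [derivAtom, output, cls_zero, sup_ite, cls_one_some, -map_finset_sup]
  | pre b p =>
    simp [derivAtom, output, cls_zero, sup_ite,
      cls_pre_unfold hΔ b ((isGuardedProc_pre b).1 hs), -map_finset_sup]
  | _ => exact hs'.elim

-- Apply `cls_atom` to each summand and exchange the suprema over summands and letters; prefixing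
-- commutes with finite suprema by T1 and T2.
open Classical in
theorem sup_cls_eq [Fintype A] (hΔ : Δ.Extends Γ) (S : Finset (Term A K))
    (hS : ∀ s ∈ S, Γ.IsGuardedProc s ∧ s.IsSummand) :
    S.sup Δ.cls = (Finset.univ.sup fun a => Cls.pre Δ a ((Γ.derivSet S a).sup Δ.cls)) ⊔
      Δ.cls (output (.one none ∈ S)) := by
  have h1 : S.sup (fun s => Δ.cls (output (s = .one none))) =
      Δ.cls (output (.one none ∈ S) : Term A K) := by
    refine le_antisymm (Finset.sup_le fun s hs => ?_) ?_
    · by_cases h : s = .one none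
      · subst h; simp [hs]
      · simp [h, output, cls_zero]
    · by_cases h : (.one none : Term A K) ∈ S
      · have := Finset.le_sup (f := fun s : Term A K => Δ.cls (output (s = .one none))) h
        simpa [h] using this
      · simp [h, output, cls_zero]
  calc S.sup Δ.cls = S.sup (fun s =>
        (Finset.univ.sup fun a => Cls.pre Δ a ((Γ.derivAtom a s).sup Δ.cls)) ⊔
        Δ.cls (output (s = .one none))) :=
        Finset.sup_congr rfl fun s hs => cls_atom hΔ (hS s hs).1 (hS s hs).2
    _ = _ := by
      rw [← h1]
      simp only [derivSet, Finset.sup_biUnion, map_finset_sup, Function.comp_def]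
      exact (Finset.sup_sup).trans (congrArg (· ⊔ _) (Finset.sup_comm _ _ _))

-- The sums of summand sets solve the deterministic equations of the subset automaton. Derivatives
-- are taken in `Γ`, but provability is over an extension, which will hold the fresh constants.
open Classical in
theorem deriv_sumList_toList [Fintype A] (hΔ : Δ.Extends Γ) (S : Finset (Term A K))
    (hS : ∀ s ∈ S, Γ.IsGuardedProc s ∧ s.IsSummand) :
    Δ.Deriv (sumList S.toList)
      (node (fun a => sumList (Γ.derivSet S a).toList) (.one none ∈ S)) := by
  have h1 : ∀ s ∈ S, Δ.IsGuardedProc s := fun s hs => (hS s hs).1.mono hΔ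
  have h2 : ∀ a, ∀ s ∈ Γ.derivSet S a, Δ.IsGuardedProc s := by
    intro a s hs
    obtain ⟨t, ht, hs⟩ := Finset.mem_biUnion.1 hs
    exact (isGuardedProc_derivAtom (hS t ht).1 a s hs).mono hΔ
  have h1' : Δ.IsGuardedProc (sumList S.toList) :=
    isGuardedProc_sumList fun p hp => h1 p (Finset.mem_toList.1 hp)
  have h2' : ∀ a, Δ.IsGuardedProc (sumList (Γ.derivSet S a).toList) := fun a =>
    isGuardedProc_sumList fun p hp => h2 a p (Finset.mem_toList.1 hp)
  rw [← cls_eq_iff h1' (isGuardedProc_node (fun a => (h2' a).1) _), cls_sumList_toList h1,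
    cls_node fun a => (h2' a).1, sup_cls_eq hΔ S hS]
  simp only [cls_pre _ (h2' _), cls_sumList_toList (h2 _)]

theorem deriv_summands (hΔ : Δ.Extends Γ) (hp : Γ.IsProc p) :
    Δ.Deriv p (sumList (Γ.unfold p).summands.toList) := by
  have hu := isGuardedProc_unfold hp
  have h : ∀ s ∈ (Γ.unfold p).summands, Δ.IsGuardedProc s := fun s hs =>
    (isGuardedProc_of_mem_summands hu hs).mono hΔ
  refine .trans (deriv_unfold hΔ hp) ?_
  rw [← cls_eq_iff (hu.mono hΔ)
    (isGuardedProc_sumList fun s hs => h s (Finset.mem_toList.1 hs)), cls_sumList_toList h,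
    cls_eq_sup_summands (hu.mono hΔ)]

end Env
end SFM

/-! ### Deterministic systems of equations and uniqueness of their solutions -/

namespace SFM
namespace Env

variable {A K : Type*}

section Node

variable [Fintype A]

theorem isGuarded_node {Y : A → Term A K} (hY : ∀ a, (Y a).IsLegal) (b : Bool) :
    (node Y b).IsGuarded := by
  refine ⟨?_, by unfold output; split <;> trivial⟩
  generalize (Finset.univ : Finset A).toList = l
  induction l with
  | nil => trivial
  | cons a l ih => exact ⟨hY a, ih⟩

theorem inst_node (θ : K → K) (x : ℕ) (r : Term A K) (Y : A → Term A K) (b : Bool) :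
    Term.inst θ x r (node Y b) = node (fun a => Term.inst θ x r (Y a)) b := by
  have h1 : Term.inst θ x r (output b) = output b := by unfold output; split <;> rfl
  have h2 : ∀ l : List A, Term.inst θ x r (sumList (l.map fun a => .pre a (Y a))) =
      sumList (l.map fun a => .pre a (Term.inst θ x r (Y a))) := by
    intro l
    induction l with
    | nil => rfl
    | cons a l ih => exact congrArg (Term.plus _) ih
  simp only [node, Term.inst, h1, h2]

theorem syn_node (Y : A → Term A K) (b : Bool) : (node Y b).syn = ⋃ a, (Y a).syn := by
  have h1 : (output b : Term A K).syn = ∅ := by unfold output; split <;> rfl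
  have h2 : ∀ l : List A, (sumList (l.map fun a => .pre a (Y a))).syn = ⋃ a ∈ l, (Y a).syn := by
    intro l
    induction l with
    | nil => simp [sumList, Term.syn]
    | cons a l ih =>
      have : (sumList ((a :: l).map fun a => .pre a (Y a))).syn = (Y a).syn ∪ ⋃ a ∈ l, (Y a).syn :=
        congrArg ((Y a).syn ∪ ·) ih
      simpa [Set.iUnion_or, Set.iUnion_union_distrib] using this
  simp [node, Term.syn, h1, h2]

theorem vars_node (Y : A → Term A K) (b : Bool) : (node Y b).vars = ⋃ a, (Y a).vars := by
  have h1 : (output b : Term A K).vars = ∅ := by unfold output; split <;> rfl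
  have h2 : ∀ l : List A, (sumList (l.map fun a => .pre a (Y a))).vars = ⋃ a ∈ l, (Y a).vars := by
    intro l
    induction l with
    | nil => simp [sumList, Term.vars]
    | cons a l ih =>
      have : (sumList ((a :: l).map fun a => .pre a (Y a))).vars = (Y a).vars ∪ ⋃ a ∈ l, (Y a).vars :=
        congrArg ((Y a).vars ∪ ·) ih
      simpa [Set.iUnion_or, Set.iUnion_union_distrib] using this
  simp [node, Term.vars, h1, h2]

end Node

/-- The possible values of an unknown of a system of equations: a constant, the open variable, or
the given solution `b`. -/
inductive Slot (κ : Type*) where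
  | bound : Slot κ
  | hole : Slot κ
  | sol (b : κ) : Slot κ

instance {κ : Type*} [Finite κ] : Finite (Slot κ) :=
  Finite.of_injective (β := Option (Option κ))
    (fun | .bound => none | .hole => some none | .sol b => some (some b))
    (by rintro (_ | _ | _) (_ | _ | _) <;> simp)

/-- A deterministic system of equations `X i = ∑ a, a.(X (d i a)) + o i`, a family of closed terms
for its unknowns, and fresh constants for its partial solutions. -/
structure System [DecidableEq K] (Γ : Env A K) (I κ : Type*) where
  d : I → A → I
  o : I → Bool
  fam : κ → I → Term A K
  proc : ∀ b i, Γ.IsProc (fam b i)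
  ι : I × (I → Slot κ) ↪ K
  fresh : ∀ n, ι n ∉ Γ.dom

namespace System

variable [DecidableEq K] {Γ : Env A K} {I κ : Type*} (S : Γ.System I κ)

/-- The unknowns on which the partial solution for `i` depends, where `f` tells which unknowns are
solved for. -/
inductive Touch (f : I → Slot κ) (i : I) : I → Prop
  | refl : Touch f i i
  | next {j : I} (a : A) (h : Touch f i j) (hj : f j = .bound) : Touch f i (S.d j a)

open Classical in
/-- Forget the value of the unknowns on which the partial solution for `i` does not depend. -/
noncomputable def norm (f : I → Slot κ) (i : I) : I → Slot κ :=
  fun j => if S.Touch f i j then f j else .hole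

/-- The constant for the unknown `i` of the system whose other unknowns are given by `f`. -/
noncomputable def con (f : I → Slot κ) (i : I) : K := S.ι (i, S.norm f i)

/-- The value of the unknown `i` according to `f`. -/
noncomputable def val (f : I → Slot κ) (i : I) : Term A K :=
  match f i with
  | .bound => .const (S.con f i)
  | .hole => .var 0
  | .sol b => S.fam b i

/-- The right-hand side of the equation for `i`. -/
noncomputable def rhs [Fintype A] (f : I → Slot κ) (i : I) : Term A K :=
  node (fun a => S.val f (S.d i a)) (S.o i)

theorem val_legal (f : I → Slot κ) (i : I) : (S.val f i).IsLegal := by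
  unfold val
  split
  · exact Or.inl trivial
  · exact Or.inl trivial
  · exact (S.proc _ _).legal

variable {S} {f g : I → Slot κ} {i j k : I}

theorem Touch.congr (hfg : ∀ j, S.Touch f i j → f j = g j) (h : S.Touch f i j) :
    S.Touch g i j := by
  induction h with
  | refl => exact .refl
  | next a h hj ih => exact .next a ih ((hfg _ h).symm.trans hj)

theorem Touch.trans (h : S.Touch f i j) (h' : S.Touch f j k) : S.Touch f i k := by
  induction h' with
  | refl => exact h
  | next a _ hj ih => exact .next a ih hj

theorem norm_apply (h : S.Touch f i j) : S.norm f i j = f j := if_pos h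

theorem norm_congr (hfg : ∀ j, S.Touch f i j → f j = g j) : S.norm f i = S.norm g i := by
  funext j
  have : S.Touch f i j ↔ S.Touch g i j := by
    refine ⟨.congr hfg, fun h => ?_⟩
    induction h with
    | refl => exact .refl
    | next a _ hj ih => exact .next a ih ((hfg _ ih).trans hj)
  by_cases h : S.Touch f i j
  · rw [norm_apply h, norm_apply (this.1 h), hfg j h]
  · exact (if_neg h).trans (if_neg (mt this.2 h)).symm

/-- This is the purpose of `norm`: `IsSubst` must fix each constant that is not open on the
variable, so partial solutions that do not depend on the changed unknown must bear the same name. -/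
theorem con_congr (hfg : ∀ j, S.Touch f i j → f j = g j) : S.con f i = S.con g i := by
  rw [con, con, norm_congr hfg]

theorem con_norm (h : S.Touch f i j) : S.con (S.norm f i) j = S.con f j :=
  (con_congr fun _ hl => (norm_apply (h.trans hl)).symm).symm

theorem val_norm (h : S.Touch f i j) : S.val (S.norm f i) j = S.val f j := by
  unfold val
  rw [norm_apply h, con_norm h]

/-- A fresh constant is defined through a normalised assignment. As `i` is bound, the unknowns on
its right-hand side are all touched, so normalising changes nothing there. -/
theorem rhs_norm [Fintype A] (h : f i = .bound) : S.rhs (S.norm f i) i = S.rhs f i := by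
  simp only [rhs, val_norm (Touch.next _ Touch.refl h)]

theorem con_injective (h : S.con f i = S.con g j) : i = j :=
  congrArg Prod.fst (S.ι.injective h)

theorem con_not_proc (C : K) (hC : Γ.IsProc (.const C)) : C ≠ S.con f i :=
  fun h => S.fresh _ (h ▸ hC.mem_dom)

variable (S) in
/-- The constants of the solved unknowns of `f` and of the closed processes. -/
def used (f : I → Slot κ) : Set K :=
  {C | Γ.IsProc (.const C) ∨ ∃ i, f i = .bound ∧ C = S.con f i}

theorem syn_val (f : I → Slot κ) (i : I) : (S.val f i).syn ⊆ S.used f := by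
  unfold val
  split
  · rintro _ rfl
    exact Or.inr ⟨i, ‹_›, rfl⟩
  · exact Set.empty_subset _
  · exact fun C hC => Or.inl ((S.proc _ _).const_of_mem hC)

theorem syn_rhs [Fintype A] (f : I → Slot κ) (i : I) : (S.rhs f i).syn ⊆ S.used f := by
  rw [rhs, syn_node]
  exact Set.iUnion_subset fun a => syn_val f _

theorem vars_val (f : I → Slot κ) (i : I) : (S.val f i).vars ⊆ {x | x = 0 ∧ f i = .hole} := by
  unfold val
  split
  · exact Set.empty_subset _
  · rintro x rfl
    exact ⟨rfl, ‹_›⟩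
  · rw [(S.proc _ _).vars_eq]
    exact Set.empty_subset _

theorem vars_rhs [Fintype A] (f : I → Slot κ) (i : I) :
    (S.rhs f i).vars ⊆ {x | x = 0 ∧ ∃ j, f j = .hole} := by
  rw [rhs, vars_node]
  refine Set.iUnion_subset fun a => (vars_val f _).trans ?_
  exact fun x hx => ⟨hx.1, _, hx.2⟩

variable (S)
variable [Fintype A] [Finite I] [Finite κ]

/-- The definitions of `Γ`, together with those of the partial solutions of the system. -/
noncomputable def env : Env A K where
  dom := Γ.dom ∪ (Set.finite_range S.ι).toFinset
  body := Function.extend S.ι (fun n => S.rhs n.2 n.1) Γ.body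
  guarded := by
    intro C hC
    by_cases h : ∃ n, S.ι n = C
    · obtain ⟨n, rfl⟩ := h
      rw [S.ι.injective.extend_apply]
      exact isGuarded_node (fun a => S.val_legal _ _) _
    · rw [Function.extend_apply' _ _ _ h]
      refine Γ.guarded C ((Finset.mem_union.1 hC).resolve_right fun h' => h ?_)
      simpa using h'

theorem env_body : S.env.body = Function.extend S.ι (fun n => S.rhs n.2 n.1) Γ.body := rfl

theorem env_extends : S.env.Extends Γ := by
  rintro C s ⟨hC, hs⟩
  refine ⟨Finset.mem_union_left _ hC, ?_⟩
  rw [env_body, Function.extend_apply', hs]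
  rintro ⟨n, rfl⟩
  exact S.fresh n hC

variable {S}

theorem con_defines (h : f i = .bound) : S.env.Defines (S.con f i) (S.rhs f i) := by
  refine ⟨Finset.mem_union_right _ (by simp [con]), ?_⟩
  rw [env_body, con, S.ι.injective.extend_apply]
  exact rhs_norm h

theorem used_body {C : K} (hC : C ∈ S.used f) : C ∈ S.env.dom ∧
    (S.env.body C).vars ⊆ {x | x = 0 ∧ ∃ j, f j = .hole} ∧ (S.env.body C).syn ⊆ S.used f := by
  rcases hC with hC | ⟨i, hi, rfl⟩
  · obtain ⟨h1, h2⟩ := S.env_extends C _ ⟨hC.mem_dom, rfl⟩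
    rw [h2, hC.body.1.vars_eq]
    exact ⟨h1, Set.empty_subset _, fun D hD => Or.inl (hC.body.1.const_of_mem hD)⟩
  · obtain ⟨h1, h2⟩ := con_defines (S := S) hi
    rw [h2]
    exact ⟨h1, vars_rhs f i, syn_rhs f i⟩

theorem consts_subset_used {p : Term A K} (hp : p.syn ⊆ S.used f) :
    (S.env.consts p : Set K) ⊆ S.used f :=
  S.env.consts_subset (fun _ hC _ => (used_body hC).2.2) hp

theorem isProc_val (hf : ∀ j, f j ≠ .hole) (i : I) : S.env.IsProc (S.val f i) := by
  refine (S.env.isProc_iff _).2 ⟨S.val_legal f i, ?_, S.used f, fun C hC => ?_, syn_val f i⟩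
  · exact Set.subset_empty_iff.1 ((vars_val f i).trans fun x hx => hf i hx.2)
  · obtain ⟨h1, h2, h3⟩ := used_body hC
    exact ⟨h1, Set.subset_empty_iff.1 (h2.trans fun x ⟨_, j, hj⟩ => hf j hj), h3⟩

theorem con_mem_consts (h : S.Touch f i j) (hj : f j = .bound) :
    S.con f j ∈ S.env.consts (.const (S.con f i)) := by
  induction h with
  | refl => exact S.env.syn_subset_consts _ rfl
  | @next j a _ hj' ih =>
    obtain ⟨h1, h2⟩ := con_defines (S := S) hj'
    refine S.env.consts_closed (ih hj') h1 ?_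
    rw [h2, rhs, syn_node]
    refine Set.mem_iUnion.2 ⟨a, ?_⟩
    simp [val, hj, Term.syn]

/-- Used contrapositively: if a constant is not open on the variable, its dependencies avoid the
hole. -/
theorem mem_fv_con (hi : f i = .bound) (h : S.Touch f i j) (hj : f j = .hole) :
    0 ∈ S.env.fv (.const (S.con f i)) := by
  cases h with
  | refl => rw [hi] at hj; cases hj
  | @next j a h hj' =>
    obtain ⟨h1, h2⟩ := con_defines (S := S) hj'
    refine Or.inr ⟨_, con_mem_consts h hj', h1, ?_⟩
    rw [h2, rhs, vars_node]
    refine Set.mem_iUnion.2 ⟨a, ?_⟩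
    simp [val, hj, Term.vars]

/-- Closing the open unknown `k`, that is, giving it the value prescribed by `g`. -/
theorem isSubst_rhs (hk : ∀ j, f j = .hole ↔ j = k) (hfg : ∀ j, j ≠ k → f j = g j) (i : I) :
    S.env.IsSubst 0 (S.val g k) (S.rhs f i) (S.rhs g i) := by
  classical
  -- By `con_injective` the unknown `j` is recovered from the constant, so the choice is harmless;
  -- constants of processes of `Γ` stay fixed.
  let θ : K → K := fun C => if h : ∃ j, C = S.con f j then S.con g h.choose else C
  have θ_con : ∀ j, θ (S.con f j) = S.con g j := by
    intro j
    have h : ∃ l, S.con f j = S.con f l := ⟨j, rfl⟩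
    have h' : θ (S.con f j) = S.con g h.choose := dif_pos h
    rw [h', ← con_injective h.choose_spec]
  have θ_proc : ∀ C, Γ.IsProc (.const C) → θ C = C := by
    intro C hC
    exact dif_neg fun ⟨j, hj⟩ => con_not_proc C hC hj
  have inst_val : ∀ j, Term.inst θ 0 (S.val g k) (S.val f j) = S.val g j := by
    intro j
    rcases hj : f j with _ | _ | b
    · have hjk : j ≠ k := fun h => by rw [(hk j).2 h] at hj; cases hj
      have hj' := hfg j hjk ▸ hj
      simp [val, hj, hj', Term.inst, θ_con]
    · obtain rfl := (hk j).1 hj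
      rw [val.eq_def _ f, hj]
      simp [Term.inst]
    · have hjk : j ≠ k := fun h => by rw [(hk j).2 h] at hj; cases hj
      have hj' := hfg j hjk ▸ hj
      simp only [val, hj, hj']
      exact Term.inst_eq_self (S.proc b j).vars_eq fun C hC =>
        θ_proc C ((S.proc b j).const_of_mem hC)
  have inst_rhs : ∀ j, Term.inst θ 0 (S.val g k) (S.rhs f j) = S.rhs g j := by
    intro j
    simp only [rhs, inst_node, inst_val]
  have hsub := consts_subset_used (S := S) (syn_rhs f i)
  refine ⟨θ, ?_, ?_, ?_, (inst_rhs i).symm⟩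
  · intro C hC D hD hCD
    rcases hsub hC with hC | ⟨j, hj, rfl⟩ <;> rcases hsub hD with hD | ⟨l, hl, rfl⟩
    · rwa [θ_proc C hC, θ_proc D hD] at hCD
    · rw [θ_proc C hC, θ_con] at hCD
      exact absurd hCD (con_not_proc C hC)
    · rw [θ_proc D hD, θ_con] at hCD
      exact absurd hCD.symm (con_not_proc D hD)
    · rw [θ_con, θ_con] at hCD
      rw [con_injective hCD]
  · intro C hC hfv
    rcases hsub hC with hC | ⟨j, hj, rfl⟩
    · exact θ_proc C hC
    · rw [θ_con]
      refine (con_congr fun l hl => hfg l fun hlk => hfv ?_).symm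
      exact mem_fv_con hj hl ((hk l).2 hlk)
  · intro C hC hfv s hs
    rcases hsub hC with hC | ⟨j, hj, rfl⟩
    · rw [(hC.mono S.env_extends).2.2] at hfv
      exact hfv.elim
    · have hjk : j ≠ k := fun h => by rw [(hk j).2 h] at hj; cases hj
      rw [θ_con, ← hs.2, (con_defines hj).2, inst_rhs]
      exact con_defines (hfg j hjk ▸ hj)

/-- Uniqueness of the solution of a system, where some unknowns are already given. -/
theorem deriv_con (b : κ) (hb : ∀ i, S.env.Deriv (S.fam b i)
      (node (fun a => S.fam b (S.d i a)) (S.o i)))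
    (n : ℕ) (f : I → Slot κ) (hf : ∀ i, f i = .bound ∨ f i = .sol b)
    (hn : {i | f i = .bound}.ncard = n) (k : I) (hk : f k = .bound) :
    S.env.Deriv (.const (S.con f k)) (S.fam b k) := by
  classical
  induction n generalizing f k with
  | zero =>
    rw [Set.ncard_eq_zero] at hn
    exact absurd hk (Set.eq_empty_iff_forall_notMem.1 hn k)
  | succ n ih =>
    -- In the coming use of R2, `h` yields the open term `p`, `f` yields `p{C/x}`, the definition of
    -- `C`, and `g` yields `p{q/x}` with `q` the given solution at `k`.
    let h := Function.update f k .hole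
    let g := Function.update f k (.sol b)
    have hh : ∀ j, h j = .hole ↔ j = k := by
      intro j
      by_cases hjk : j = k
      · simp [h, hjk]
      · rcases hf j with hj | hj <;> simp [h, hjk, hj]
    have hg : ∀ j, g j = .bound ∨ g j = .sol b := by
      intro j
      by_cases hjk : j = k
      · simp [g, hjk]
      · simpa [g, hjk] using hf j
    have ne_hole : ∀ {f : I → Slot κ}, (∀ j, f j = .bound ∨ f j = .sol b) → ∀ j, f j ≠ .hole := by
      intro f hf j hj
      rcases hf j with h | h <;> rw [h] at hj <;> cases hj
    have hgn : {i | g i = .bound}.ncard = n := by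
      have : {i | f i = .bound} = insert k {i | g i = .bound} := by
        ext j
        by_cases hjk : j = k <;> simp [g, hjk, hk]
      rw [this, Set.ncard_insert_of_notMem (by simp [g])] at hn
      omega
    -- `g` has one bound unknown fewer, so by induction its constants are already provably equal to
    -- the given solution.
    have hval : ∀ j, S.env.Deriv (S.fam b j) (S.val g j) := by
      intro j
      rcases hg j with hj | hj
      · rw [show S.val g j = .const (S.con g j) by simp [val, hj]]
        exact .symm (ih g hg hgn j hj)
      · rw [show S.val g j = S.fam b j by simp [val, hj]]
        exact .refl ((S.proc b j).mono S.env_extends)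
    have hfk : S.val f k = .const (S.con f k) := by simp [val, hk]
    have hgk : S.val g k = S.fam b k := by simp [val, g]
    have hsf := isSubst_rhs (S := S) (g := f) hh (fun j hj => by simp [h, hj]) k
    have hsg := isSubst_rhs (S := S) (g := g) hh (fun j hj => by simp [h, g, hj]) k
    rw [hfk] at hsf
    rw [hgk] at hsg
    have hsub := consts_subset_used (S := S) (syn_rhs h k)
    refine .R2 (hfk ▸ isProc_val (ne_hole hf) k)
      ⟨isGuarded_node (fun _ => S.val_legal _ _) _, fun C hC => (used_body (hsub hC)).1, ?_⟩
      ?_ hsf (con_defines hk) hsg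
      (.trans (hb k) (deriv_node (fun a => (S.proc b _).mono S.env_extends)
        (fun a => isProc_val (ne_hole hg) _) (fun a => hval _) _))
    · rintro x (hx | ⟨C, hC, -, hx⟩)
      · exact (vars_rhs _ _ hx).1
      · exact ((used_body (hsub hC)).2.1 hx).1
    -- A constant used by the open term stands for an unknown bound in `h`, hence different from
    -- `k`, and constants of different unknowns differ.
    · intro hC
      rcases hsub hC with hC | ⟨j, hj, hC⟩
      · exact con_not_proc _ hC rfl
      · rw [← con_injective hC, (hh k).2 rfl] at hj
        cases hj

/-- Any two solutions of a deterministic system of equations are provably equal. -/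
theorem deriv_fam (hS : ∀ b i, S.env.Deriv (S.fam b i)
      (node (fun a => S.fam b (S.d i a)) (S.o i))) (b c : κ) (k : I) :
    S.env.Deriv (S.fam b k) (S.fam c k) :=
  -- With every unknown bound, the constant depends on neither solution and so links the two.
  .trans (.symm (deriv_con b (hS b) _ (fun _ => .bound) (fun _ => Or.inl rfl) rfl k rfl))
    (deriv_con c (hS c) _ (fun _ => .bound) (fun _ => Or.inl rfl) rfl k rfl)

end System

end Env
end SFM

/-! ### A finite state space, and the system of equivalent pairs -/

namespace SFM

/-- The subterms of a term. -/
noncomputable def Term.subterms {A K : Type*} : Term A K → Finset (Term A K)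
  | .pre a p => insert (.pre a p) p.subterms
  | .plus p q => insert (.plus p q) (p.subterms ∪ q.subterms)
  | p => {p}

namespace Env

variable {A K : Type*}

/-- A set of terms closed under subterms and definitions. -/
structure IsClosed (Γ : Env A K) (U : Set (Term A K)) : Prop where
  pre : ∀ a p, .pre a p ∈ U → p ∈ U
  plus : ∀ p q, .plus p q ∈ U → p ∈ U ∧ q ∈ U
  const : ∀ C ∈ Γ.dom, .const C ∈ U → Γ.body C ∈ U

theorem exists_fresh_embedding {N : Type*} [Finite N] [Infinite K] (s : Finset K) :
    ∃ ι : N ↪ K, ∀ n, ι n ∉ s := by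
  have : Infinite {C // C ∉ s} := s.finite_toSet.infinite_compl.to_subtype
  obtain ⟨n, ⟨e⟩⟩ := Finite.exists_equiv_fin N
  exact ⟨(e.toEmbedding.trans Fin.valEmbedding).trans
    ((Infinite.natEmbedding {C // C ∉ s}).trans (.subtype _)), fun n =>
    (Infinite.natEmbedding {C // C ∉ s} (e n)).2⟩

theorem self_mem_subterms (p : Term A K) : p ∈ p.subterms := by
  cases p <;> simp [Term.subterms]

theorem subterms_closed (p : Term A K) : (∀ a q, .pre a q ∈ p.subterms → q ∈ p.subterms) ∧
    ∀ q r, .plus q r ∈ p.subterms → q ∈ p.subterms ∧ r ∈ p.subterms := by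
  induction p with
  | pre b p ih =>
    have := self_mem_subterms p
    simp only [Term.subterms, Finset.mem_insert]
    grind
  | plus p q ihp ihq =>
    have := self_mem_subterms p
    have := self_mem_subterms q
    simp only [Term.subterms, Finset.mem_insert, Finset.mem_union]
    grind
  | _ => simp [Term.subterms]

variable {Γ : Env A K}

/-- Adding the finitely many bodies of definitions at once and then taking subterms suffices, with
no iteration. -/
theorem exists_isClosed (Γ : Env A K) (s : Finset (Term A K)) :
    ∃ U : Finset (Term A K), s ⊆ U ∧ Γ.IsClosed U := by
  classical
  have sub : ∀ t ∈ s ∪ Γ.dom.image Γ.body,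
      t.subterms ⊆ (s ∪ Γ.dom.image Γ.body).biUnion Term.subterms :=
    fun t ht => Finset.subset_biUnion_of_mem Term.subterms ht
  refine ⟨(s ∪ Γ.dom.image Γ.body).biUnion Term.subterms,
    fun p hp => sub p (Finset.mem_union_left _ hp) (self_mem_subterms p), ?_, ?_, ?_⟩
  · intro a p hp
    obtain ⟨t, ht, hp⟩ := Finset.mem_biUnion.1 (Finset.mem_coe.1 hp)
    exact sub t ht ((subterms_closed t).1 a p hp)
  · intro p q hp
    obtain ⟨t, ht, hp⟩ := Finset.mem_biUnion.1 (Finset.mem_coe.1 hp)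
    obtain ⟨h1, h2⟩ := (subterms_closed t).2 p q hp
    exact ⟨sub t ht h1, sub t ht h2⟩
  · intro C hC _
    exact sub _ (Finset.mem_union_right _ (Finset.mem_image_of_mem _ hC)) (self_mem_subterms _)

theorem IsClosed.summands {U : Set (Term A K)} (hU : Γ.IsClosed U) {p : Term A K} (hp : p ∈ U) :
    (p.summands : Set (Term A K)) ⊆ U := by
  induction p with
  | zero => simp [Term.summands]
  | plus p q ihp ihq =>
    obtain ⟨h1, h2⟩ := hU.plus p q hp
    simp [Term.summands, ihp h1, ihq h2]
  | _ => simpa [Term.summands] using hp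

variable [DecidableEq K]

theorem IsClosed.summands_unfold {U : Set (Term A K)} (hU : Γ.IsClosed U) {p : Term A K}
    (hp : p ∈ U) (hp' : Γ.IsProc p) : ((Γ.unfold p).summands : Set (Term A K)) ⊆ U := by
  refine hU.summands ?_
  cases p with
  | const C => exact hU.const C hp'.mem_dom hp
  | _ => exact hp

open Classical in
/-- The guarded processes in `U` that are not sums. -/
noncomputable def atoms (Γ : Env A K) (U : Finset (Term A K)) : Finset (Term A K) :=
  -- `ε.1` is added because it is the derivative of `a.1` and may be absent from `U`.
  {s ∈ insert (.one none) U | Γ.IsGuardedProc s ∧ s.IsSummand}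

theorem mem_atoms {U : Finset (Term A K)} {s : Term A K} : s ∈ Γ.atoms U ↔
    s ∈ insert (.one none) U ∧ Γ.IsGuardedProc s ∧ s.IsSummand := by
  classical
  exact Finset.mem_filter

theorem isGuardedProc_of_mem_atoms {U : Finset (Term A K)} {s : Term A K} (hs : s ∈ Γ.atoms U) :
    Γ.IsGuardedProc s ∧ s.IsSummand := (mem_atoms.1 hs).2

theorem summands_subset_atoms {U : Finset (Term A K)} (hU : Γ.IsClosed U) {p : Term A K}
    (hp : p ∈ U) (hp' : Γ.IsProc p) : (Γ.unfold p).summands ⊆ Γ.atoms U := by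
  have hu := isGuardedProc_unfold hp'
  exact fun s hs => mem_atoms.2 ⟨Finset.mem_insert_of_mem (hU.summands_unfold hp hp' hs),
    isGuardedProc_of_mem_summands hu hs, isSummand_of_mem_summands hu.2 hs⟩

theorem derivSet_subset_atoms {U S : Finset (Term A K)} (hU : Γ.IsClosed U) (hS : S ⊆ Γ.atoms U)
    (a : A) : Γ.derivSet S a ⊆ Γ.atoms U := by
  refine Finset.biUnion_subset.2 fun s hs => ?_
  obtain ⟨h1, h2, -⟩ := mem_atoms.1 (hS hs)
  intro t ht
  cases s with
  | one α =>
    cases α with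
    | none => simp [derivAtom] at ht
    | some b =>
      simp only [derivAtom] at ht
      split at ht
      · rw [Finset.mem_singleton.1 ht]
        exact mem_atoms.2
          ⟨Finset.mem_insert_self _ _, Γ.isGuardedProc_one _, trivial⟩
      · simp at ht
  | pre b p =>
    simp only [derivAtom] at ht
    split at ht
    · have hp : Term.pre b p ∈ U := (Finset.mem_insert.1 h1).resolve_left (by simp)
      exact summands_subset_atoms hU (hU.pre b p hp) ((isGuardedProc_pre b).1 h2) ht
    · simp at ht
  | _ => simp [derivAtom] at ht

/-- The pairs of sets of summands from `U` that accept the same words. -/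
def EquivPair (Γ : Env A K) (U : Finset (Term A K)) : Type _ :=
  {P : Finset (Term A K) × Finset (Term A K) // (P.1 ⊆ Γ.atoms U ∧ P.2 ⊆ Γ.atoms U) ∧
    ∀ w, Γ.Accepts P.1 w ↔ Γ.Accepts P.2 w}

instance (U : Finset (Term A K)) : Finite (Γ.EquivPair U) := by
  refine Set.Finite.to_subtype
    (((Γ.atoms U).powerset ×ˢ (Γ.atoms U).powerset).finite_toSet.subset ?_)
  rintro P ⟨⟨h1, h2⟩, -⟩
  simpa using ⟨h1, h2⟩

open Classical in
/-- Sets of summands accepting the same words have provably equal sums. -/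
theorem exists_deriv_of_equiv [Finite A] [Infinite K] {U : Finset (Term A K)} (hU : Γ.IsClosed U)
    {S₁ S₂ : Finset (Term A K)} (h₁ : S₁ ⊆ Γ.atoms U) (h₂ : S₂ ⊆ Γ.atoms U)
    (h : ∀ w, Γ.Accepts S₁ w ↔ Γ.Accepts S₂ w) :
    ∃ Δ : Env A K, Δ.Extends Γ ∧ Δ.Deriv (sumList S₁.toList) (sumList S₂.toList) := by
  have := Fintype.ofFinite A
  obtain ⟨ι, hι⟩ := exists_fresh_embedding
    (N := Γ.EquivPair U × (Γ.EquivPair U → Slot Bool)) Γ.dom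
  -- The two components of the pairs are the two solutions to be compared.
  let side : Bool → Γ.EquivPair U → Finset (Term A K) := fun b P => cond b P.1.1 P.1.2
  have side_subset : ∀ b P, side b P ⊆ Γ.atoms U := by
    rintro (_ | _) P
    · exact P.2.1.2
    · exact P.2.1.1
  let S : Γ.System (Γ.EquivPair U) Bool :=
    { d := fun P a => ⟨(Γ.derivSet P.1.1 a, Γ.derivSet P.1.2 a),
        ⟨derivSet_subset_atoms hU P.2.1.1 a, derivSet_subset_atoms hU P.2.1.2 a⟩,
        -- Accepting `w` from the `a`-derivative is by definition accepting `a :: w`.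
        fun w => P.2.2 (a :: w)⟩
      o := fun P => .one none ∈ P.1.1
      fam := fun b P => sumList (side b P).toList
      proc := fun b P => (isGuardedProc_sumList fun p hp =>
        (isGuardedProc_of_mem_atoms (side_subset b P (Finset.mem_toList.1 hp))).1).1
      ι := ι
      fresh := hι }
  refine ⟨S.env, S.env_extends, System.deriv_fam (S := S) ?_ true false ⟨(S₁, S₂), ⟨h₁, h₂⟩, h⟩⟩
  intro b P
  have key := deriv_sumList_toList S.env_extends (side b P) fun s hs =>
    isGuardedProc_of_mem_atoms (side_subset b P hs)
  have ho : S.o P = decide ((.one none : Term A K) ∈ side b P) := by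
    cases b
    -- The output is read from the first component; agreement on the empty word transfers it to the
    -- second.
    · exact decide_eq_decide.2 (P.2.2 [])
    · rfl
  rw [ho]
  cases b <;> exact key

end Env
end SFM

theorem mainTheorem1 {A K : Type*} [Finite A] [DecidableEq K] [Infinite K]
    (Γ : SFM.Env A K) (p q : SFM.Term A K) (hp : Γ.IsProc p) (hq : Γ.IsProc q)
    (h : Γ.LangEquiv p q) : Γ.ProvesW p q := by
  obtain ⟨U, hpq, hU⟩ := Γ.exists_isClosed {p, q}
  have hpU : p ∈ U := hpq (by simp)
  have hqU : q ∈ U := hpq (by simp)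
  obtain ⟨Δ, hΔ, hd⟩ := SFM.Env.exists_deriv_of_equiv hU
    (SFM.Env.summands_subset_atoms hU hpU hp) (SFM.Env.summands_subset_atoms hU hqU hq)
    fun w => by
      rw [← SFM.Env.mem_lang_iff hp, ← SFM.Env.mem_lang_iff hq, show Γ.lang p = Γ.lang q from h]
  exact ⟨Δ, hΔ, .trans (SFM.Env.deriv_summands hΔ hp)
    (.trans hd (.symm (SFM.Env.deriv_summands hΔ hq)))⟩
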